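/- For integers $0<m<n$, let $G(n,m)$ be the Grassmannian of $m$-dimensional linear subspaces of $\mathbb{R}^n$, with the Borel $\sigma$-algebra of the metric $d(V,W)=\|\pi_V-\pi_W\|$, where $\pi_V\colon\mathbb{R}^n\to V$ denotes orthogonal projection (in the definition of $d$ regarded as a map into $\mathbb{R}^n$, and $\|\cdot\|$ is the operator norm). Let $\gamma_{n,m}$ be the $O(n)$-invariant Borel probability measure on $G(n,m)$, i.e. the image of the Haar probability measure of $O(n)$ under $g\mapsto gV_0$ for a fixed $V_0\in G(n,m)$. Let $\dim_{\mathrm H}$ denote Hausdorff dimension. For $K\subset\mathbb{R}^n$ let $$\dim_{\mathrm p}K=\inf\Big\{\sup_{i}\overline{\dim}_{\mathrm B}F_i : F_i\subset\mathbb{R}^n \text{ bounded},\ K\subset\bigcup_{i\in\mathbb{N}}F_i\Big\},\qquad \overline{\dim}_{\mathrm B}F=\limsup_{\delta\to0+}\frac{\log N(F,\delta)}{-\log\delta},$$ be the packing dimension, where $N(F,\delta)$ is the least number of open balls of radius $\delta$ required to cover the bounded set $F$ (and $\overline{\dim}_{\mathrm B}\emptyset=0$). **Theorem.** Let $0<m<n$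 be integers, and let $K\subset\mathbb{R}^n$ be an arbitrary set (not assumed Borel or analytic) with $\dim_{\mathrm H}K=\dim_{\mathrm p}K$. Then $$\dim_{\mathrm H}\pi_V(K)=\min\{\dim_{\mathrm H}K,\,m\}\qquad\text{for } \gamma_{n,m}\text{-almost every } V\in G(n,m).$$ -/

import Mathlib

open MeasureTheory Filter Topology Set

noncomputable section

namespace RealProjection

/-- Euclidean `n`-space `ℝⁿ`. -/
abbrev E (n : ℕ) : Type := EuclideanSpace ℝ (Fin n)

/-! ### Upper box dimension and packing dimension -/

/-- `N(F, δ)`: the least number of open `δ`-balls, with arbitrary centres in `ℝⁿ`, required to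
cover `F`. It is used only for bounded sets `F` and `δ > 0`, for which finite covers exist. -/
def coveringNumber {n : ℕ} (F : Set (E n)) (δ : ℝ) : ℕ :=
  sInf {k : ℕ | ∃ c : Finset (E n), c.card = k ∧ F ⊆ ⋃ x ∈ c, Metric.ball x δ}

/-- The upper box dimension `limsup_{δ → 0+} log N(F, δ) / (-log δ)` of a bounded set `F ⊆ ℝⁿ`.
For nonempty `F` and `0 < δ < 1` the quotient is nonnegative, so `ENNReal.ofReal` loses nothing;
the empty set gets dimension `0`. -/
def upperBoxDim {n : ℕ} (F : Set (E n)) : ENNReal :=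
  limsup (fun δ : ℝ => ENNReal.ofReal (Real.log (coveringNumber F δ) / (-Real.log δ))) (𝓝[>] 0)

/-- The packing dimension of a set `K ⊆ ℝⁿ`: the infimum of `sup_i upperBoxDim (F i)` over all
countable covers of `K` by bounded sets `F i`. -/
def packingDim {n : ℕ} (K : Set (E n)) : ENNReal :=
  ⨅ (F : ℕ → Set (E n)) (_ : (∀ i, Bornology.IsBounded (F i)) ∧ K ⊆ ⋃ i, F i),
    ⨆ i, upperBoxDim (F i)

/-! ### The Grassmannian `G(n, m)` -/

/-- `G(n, m)`: the `m`-dimensional linear subspaces of `ℝⁿ`. -/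
def Grassmannian (n m : ℕ) : Type := {V : Submodule ℝ (E n) // Module.finrank ℝ V = m}

/-- The metric `d(V, W) = ‖π_V - π_W‖` (operator norm) on `G(n, m)`, with the orthogonal
projections regarded as maps `ℝⁿ → ℝⁿ`. -/
instance (n m : ℕ) : MetricSpace (Grassmannian n m) :=
  MetricSpace.induced (fun V : Grassmannian n m => V.1.starProjection)
    (fun _ _ h => Subtype.ext (Submodule.starProjection_inj.mp h)) inferInstance

instance (n m : ℕ) : MeasurableSpace (Grassmannian n m) := borel _

instance (n m : ℕ) : BorelSpace (Grassmannian n m) := ⟨rfl⟩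

/-! ### Haar measure on the orthogonal group `O(n)` -/

/-- The orthogonal group `O(n)`, with the topology of entrywise convergence. -/
abbrev O (n : ℕ) : Type := Matrix.orthogonalGroup (Fin n) ℝ

instance (n : ℕ) : CompactSpace (O n) := by
  refine isCompact_iff_compactSpace.mp (?_ : IsCompact (Matrix.orthogonalGroup (Fin n) ℝ :
    Set (Matrix (Fin n) (Fin n) ℝ)))
  have hc : IsClosed ((Matrix.orthogonalGroup (Fin n) ℝ : Set (Matrix (Fin n) (Fin n) ℝ))) := by
    have : (Matrix.orthogonalGroup (Fin n) ℝ : Set (Matrix (Fin n) (Fin n) ℝ)) =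
        {A | star A * A = 1} ∩ {A | A * star A = 1} := by
      ext A; exact Unitary.mem_iff
    rw [this]
    exact (isClosed_eq (by fun_prop) (by fun_prop)).inter (isClosed_eq (by fun_prop) (by fun_prop))
  have hK : IsCompact (Set.pi univ fun _ : Fin n => Set.pi univ fun _ : Fin n =>
      Metric.closedBall (0 : ℝ) 1) :=
    isCompact_univ_pi fun _ => isCompact_univ_pi fun _ => isCompact_closedBall _ _
  refine hK.of_isClosed_subset hc fun A hA i _ j _ => ?_
  simpa using entry_norm_bound_of_unitary (𝕜 := ℝ) hA i j

instance (n : ℕ) : MeasurableSpace (O n) := borel _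

instance (n : ℕ) : BorelSpace (O n) := ⟨rfl⟩

/-- The Haar probability measure on the compact group `O(n)`. -/
def haarO (n : ℕ) : Measure (O n) := Measure.haarMeasure ⊤

instance (n : ℕ) : IsProbabilityMeasure (haarO n) :=
  ⟨by simpa [haarO] using Measure.haarMeasure_self (K₀ := (⊤ : TopologicalSpace.PositiveCompacts (O n)))⟩

/-! ### The invariant measure on `G(n, m)` -/

/-- The linear isometry `x ↦ g x` of `ℝⁿ` given by `g ∈ O(n)`. -/
def isometryOf {n : ℕ} (g : O n) : E n ≃ₗᵢ[ℝ] E n :=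
  Unitary.linearIsometryEquiv
    ⟨Matrix.toEuclideanCLM (n := Fin n) (𝕜 := ℝ) g.1, by
      rw [Unitary.mem_iff, ← map_star, ← map_mul, ← map_mul]
      simp⟩

/-- The isometry of `g` is multiplication of column vectors by the matrix `g`. -/
theorem isometryOf_apply {n : ℕ} (g : O n) (x : E n) :
    isometryOf g x = Matrix.toEuclideanCLM (n := Fin n) (𝕜 := ℝ) g.1 x := rfl

/-- The action of `O(n)` on `G(n, m)`: the image plane `gV`. -/
def rotate {n m : ℕ} (g : O n) (V : Grassmannian n m) : Grassmannian n m :=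
  ⟨V.1.map ((isometryOf g).toLinearEquiv : E n →ₗ[ℝ] E n), by
    rw [LinearEquiv.finrank_map_eq]; exact V.2⟩

/-- The coordinate plane spanned by the first `m` standard basis vectors of `ℝⁿ`. -/
def coordPlane {n m : ℕ} (h : m ≤ n) : Grassmannian n m :=
  ⟨Submodule.span ℝ (range fun i : Fin m => EuclideanSpace.basisFun (Fin n) ℝ (Fin.castLE h i)), by
    rw [finrank_span_eq_card]
    · simp
    · exact ((EuclideanSpace.basisFun (Fin n) ℝ).orthonormal.linearIndependent).comp _
        (Fin.castLE_injective h)⟩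

/-- `γ_{n,m}`: the `O(n)`-invariant Borel probability measure on `G(n, m)`, that is, the image of
the Haar probability measure of `O(n)` under `g ↦ g V₀`, where `V₀` is the coordinate plane. -/
def gammaMeasure {n m : ℕ} (h : m ≤ n) : Measure (Grassmannian n m) :=
  (haarO n).map fun g => rotate g (coordPlane h)

/-- The orbit map is continuous, hence `gammaMeasure` is a genuine image measure. -/
theorem continuous_rotate {n m : ℕ} (V : Grassmannian n m) : Continuous fun g : O n => rotate g V := by
  have hi : IsInducing (fun V : Grassmannian n m => V.1.starProjection) := ⟨rfl⟩
  rw [hi.continuous_iff]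
  have hL : Continuous (Matrix.toEuclideanCLM (n := Fin n) (𝕜 := ℝ)) :=
    (Matrix.toEuclideanCLM (n := Fin n) (𝕜 := ℝ)).toAlgEquiv.toLinearMap.continuous_of_finiteDimensional
  have key : ((fun V : Grassmannian n m => V.1.starProjection) ∘ fun g : O n => rotate g V) =
      fun g : O n => (Matrix.toEuclideanCLM (n := Fin n) (𝕜 := ℝ) g.1) ∘L V.1.starProjection ∘L
        (Matrix.toEuclideanCLM (n := Fin n) (𝕜 := ℝ) (g⁻¹).1) := by
    funext g
    ext1 x
    have hs : (isometryOf g).symm x = Matrix.toEuclideanCLM (n := Fin n) (𝕜 := ℝ) (g⁻¹).1 x := by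
      apply (isometryOf g).injective
      rw [LinearIsometryEquiv.apply_symm_apply, isometryOf_apply, ← mul_apply_eq_comp,
        ← map_mul, ← Submonoid.coe_mul, mul_inv_cancel]
      simp
    have hp := Submodule.starProjection_map_apply (isometryOf g) V.1 x
    rw [hs] at hp
    exact hp
  rw [key]
  have h1 : Continuous fun g : O n => Matrix.toEuclideanCLM (n := Fin n) (𝕜 := ℝ) g.1 :=
    hL.comp continuous_subtype_val
  have h2 : Continuous fun g : O n => Matrix.toEuclideanCLM (n := Fin n) (𝕜 := ℝ) (g⁻¹).1 :=
    hL.comp (continuous_subtype_val.comp continuous_inv)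
  exact h1.clm_comp (continuous_const.clm_comp h2)

instance {n m : ℕ} (h : m ≤ n) : IsProbabilityMeasure (gammaMeasure h) :=
  Measure.isProbabilityMeasure_map (continuous_rotate _).measurable.aemeasurable

end RealProjection

end

/-!
# Projections of sets with equal Hausdorff and packing dimension

The upper bound is clear: projections are `1`-Lipschitz and `V` has dimension `m`.

The lower bound is a discretised potential-theoretic argument which needs no measure on `K`, hence
no measurability of `K`. Fix `t < min (dimH K) m`. By countable stability, `K` may be replaced by a
piece `K'` with `dimH K' > s` that lies in a bounded set of upper box dimension less than `a`, where
`s < dimH K < a` are as close as desired. So `K'` has positive `s`-dimensional content, and at scale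
`δ = 2⁻ʲ` it has a `δ`-net `P` with at most `δ⁻ᵃ` points.

Suppose that the projection of `K'` to `V` has zero `t`-dimensional content. A cover of the
projection, sorted by dyadic radii, splits `K'` into pieces, one for each small scale `δ`, such that
the piece of scale `δ` projects into about `δ⁻ᵗ` balls of radius `δ`. Content is countably
subadditive on arbitrary sets, so for some `δ` the piece has content at least of order `δ ^ ε`, and
then (`exists_isFrostman_subset`) its net contains an `(s, δ)`-Frostman set with at least about
`δ ^ (ε - s)` points whose projection to `V` is covered by about `δ⁻ᵗ` balls. Such planes `V` form
the set `badPlanes`.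

The point of `dimH K = packingDim K` is that these Frostman sets, although they depend on `V` without
any regularity, are almost as large as the whole net `P`. By the Cauchy–Schwarz inequality, about
`δ ^ (-O(ε))` of them suffice for every other one to have large intersection with one of these
(`exists_subfamily_card_inter_ge`). For a fixed Frostman set `T`, the planes whose projection
compresses a large part of `T` into few balls have many pairs in `T` with nearby projections; they
are rare by Markov's inequality, because a vector `x` is almost annihilated by few planes:
`gammaMeasure {V | ‖π_V x‖ ≤ ρ} ≤ C (ρ / ‖x‖) ^ m` (`exists_gammaMeasure_le`). The resulting measures
(`exists_gammaMeasure_badPlanes_le`) are summable over the dyadic scales, and the Borel–Cantelli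
lemma, valid for outer measures, finishes the proof.
-/

noncomputable section

namespace RealProjection

open Metric
open scoped ENNReal Classical

/-! ### Hausdorff content -/

/-- The `s`-dimensional Hausdorff content (without restriction on the diameters of the covering
sets), as an outer measure. Positivity of `s` makes the empty set weightless. -/
def hausdorffContent {X : Type*} [EMetricSpace X] (s : ℝ) (hs : 0 < s) : OuterMeasure X :=
  OuterMeasure.ofFunction (fun A => ediam A ^ s) (by simp [ENNReal.zero_rpow_of_pos hs])

theorem hausdorffContent_le_ediam {X : Type*} [EMetricSpace X] {s : ℝ} (hs : 0 < s) (A : Set X) :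
    hausdorffContent s hs A ≤ ediam A ^ s :=
  OuterMeasure.ofFunction_le _

theorem hausdorffContent_le_hausdorffMeasure {X : Type*} [EMetricSpace X] [MeasurableSpace X]
    [BorelSpace X] {s : ℝ} (hs : 0 < s) (A : Set X) :
    hausdorffContent s hs A ≤ μH[s] A := by
  rw [Measure.hausdorffMeasure_apply, hausdorffContent, OuterMeasure.ofFunction_apply]
  refine le_trans ?_ (le_iSup₂ (1 : ℝ≥0∞) one_pos)
  refine le_iInf fun t => le_iInf fun ht => le_iInf fun _ => ?_
  refine (iInf₂_le t ht).trans (ENNReal.tsum_le_tsum fun k => ?_)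
  rcases (t k).eq_empty_or_nonempty with h | h
  · simp [h, ENNReal.zero_rpow_of_pos hs]
  · simp [h]

theorem exists_cover_of_hausdorffContent_lt {X : Type*} [EMetricSpace X] {s : ℝ} (hs : 0 < s)
    {A : Set X} {c : ℝ≥0∞} (h : hausdorffContent s hs A < c) :
    ∃ t : ℕ → Set X, A ⊆ ⋃ i, t i ∧ ∑' i, ediam (t i) ^ s < c := by
  rw [hausdorffContent, OuterMeasure.ofFunction_apply] at h
  simpa [iInf_lt_iff] using h

/-- Sets of content zero are null for the Hausdorff measure, since a cover with small total weight
consists of sets of small diameter. -/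
theorem hausdorffMeasure_eq_zero_of_hausdorffContent {X : Type*} [EMetricSpace X]
    [MeasurableSpace X] [BorelSpace X] {s : ℝ} (hs : 0 < s) {A : Set X}
    (h : hausdorffContent s hs A = 0) : μH[s] A = 0 := by
  have hpos : ∀ k : ℕ, (0 : ℝ≥0∞) < ((k : ℝ≥0∞) + 1)⁻¹ := fun k => by
    simp [ENNReal.add_eq_top]
  choose t htA hts using fun k : ℕ =>
    exists_cover_of_hausdorffContent_lt hs (h.trans_lt (hpos k))
  have hlim : Tendsto (fun k : ℕ => ((k : ℝ≥0∞) + 1)⁻¹) atTop (𝓝 0) := by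
    have := (tendsto_add_atTop_iff_nat 1).2 ENNReal.tendsto_inv_nat_nhds_zero
    simpa using this
  have hlim' : Tendsto (fun k : ℕ => (((k : ℝ≥0∞) + 1)⁻¹) ^ s⁻¹) atTop (𝓝 0) := by
    have := hlim.ennrpow_const s⁻¹
    rwa [ENNReal.zero_rpow_of_pos (inv_pos.2 hs)] at this
  have key := Measure.hausdorffMeasure_le_liminf_tsum s A (l := atTop) _ hlim' t
    (.of_forall fun k i => by
      rw [← ENNReal.rpow_le_rpow_iff hs, ← ENNReal.rpow_mul, inv_mul_cancel₀ hs.ne',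
        ENNReal.rpow_one]
      exact (ENNReal.le_tsum i).trans (hts k).le)
    (.of_forall htA)
  refine le_antisymm (key.trans ?_) bot_le
  rw [← hlim.liminf_eq]
  exact liminf_le_liminf (.of_forall fun k => (hts k).le)

/-! ### Discrete Frostman sets -/

/-- A finite set is `(s, δ)`-Frostman if every ball of radius `r ≥ δ` (with arbitrary centre)
contains at most `(r / δ) ^ s` of its points. -/
def IsFrostman {X : Type*} [MetricSpace X] (S : Finset X) (s δ : ℝ) : Prop :=
  ∀ x r, δ ≤ r → ((S.filter (· ∈ closedBall x r)).card : ℝ) ≤ (r / δ) ^ s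

/-- An inclusion-maximal Frostman subset `S` of `A` is large: every point of `A` lies in a ball
which `S` fills up to a factor `2`, and a Vitali subfamily of these balls shows that the content of
any set close to `A` is controlled by the cardinality of `S`. -/
theorem exists_isFrostman_subset {X : Type*} [MetricSpace X] (A : Finset X) {s δ : ℝ}
    (hs : 0 < s) (hδ : 0 < δ) :
    ∃ S ⊆ A, IsFrostman S s δ ∧ ∀ T : Set X, T ⊆ ⋃ p ∈ A, closedBall p δ →
      hausdorffContent s hs T ≤ ENNReal.ofReal (2 * (12 * δ) ^ s * S.card) := by
  have hne : (A.powerset.filter fun S => IsFrostman S s δ).Nonempty := by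
    refine ⟨∅, ?_⟩
    simp only [Finset.mem_filter, Finset.empty_mem_powerset, true_and]
    intro x r hr
    simpa using Real.rpow_nonneg (div_nonneg (hδ.le.trans hr) hδ.le) s
  obtain ⟨S, hS⟩ := Finset.exists_maximal hne
  have hSm := hS.prop
  simp only [Finset.mem_filter, Finset.mem_powerset] at hSm
  obtain ⟨hSA, hSF⟩ := hSm
  refine ⟨S, hSA, hSF, fun T hT => ?_⟩
  have hsat : ∀ p ∈ A, ∃ x r, δ ≤ r ∧ p ∈ closedBall x r ∧
      (r / δ) ^ s ≤ 2 * ((S.filter (· ∈ closedBall x r)).card : ℝ) := by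
    intro p hp
    by_cases hpS : p ∈ S
    · refine ⟨p, δ, le_rfl, mem_closedBall_self hδ.le, ?_⟩
      rw [div_self hδ.ne', Real.one_rpow]
      have : 1 ≤ (S.filter (· ∈ closedBall p δ)).card :=
        Finset.card_pos.2 ⟨p, by simp [hpS, hδ.le]⟩
      have : (1 : ℝ) ≤ ((S.filter (· ∈ closedBall p δ)).card : ℝ) := by exact_mod_cast this
      linarith
    -- If `p ∉ S`, maximality makes the Frostman condition fail for `insert p S`, in a ball around
    -- `x` that contains `p`; a count `k ≥ 1` with `k + 1 > y` satisfies `y ≤ 2 k`.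
    · have hnot : ¬ IsFrostman (insert p S) s δ := by
        intro hF
        have hmem : insert p S ∈ A.powerset.filter fun S => IsFrostman S s δ := by
          simp only [Finset.mem_filter, Finset.mem_powerset]
          exact ⟨Finset.insert_subset hp hSA, hF⟩
        exact hpS (hS.le_of_ge hmem (Finset.subset_insert p S) (Finset.mem_insert_self p S))
      simp only [IsFrostman, not_forall, not_le] at hnot
      obtain ⟨x, r, hr, hlt⟩ := hnot
      have hle := hSF x r hr
      have hpx : p ∈ closedBall x r := by
        by_contra hpx
        rw [Finset.filter_insert, if_neg hpx] at hlt
        exact absurd hle (not_le.2 hlt)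
      refine ⟨x, r, hr, hpx, ?_⟩
      rw [Finset.filter_insert, if_pos hpx, Finset.card_insert_of_notMem (by simp [hpS])] at hlt
      push_cast at hlt
      have h1 : (1 : ℝ) ≤ (r / δ) ^ s :=
        Real.one_le_rpow ((one_le_div hδ).2 hr) hs.le
      have h2 : 1 ≤ (S.filter (· ∈ closedBall x r)).card := by
        by_contra h0
        have h0' : (S.filter (· ∈ closedBall x r)).card = 0 := by omega
        rw [h0'] at hlt
        norm_num at hlt
        linarith
      have h2' : (1 : ℝ) ≤ ((S.filter (· ∈ closedBall x r)).card : ℝ) := by exact_mod_cast h2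
      linarith
  choose! x r hr hpx hfill using hsat
  obtain ⟨u, huA, hdisj, hcov⟩ := Vitali.exists_disjoint_subfamily_covering_enlargement_closedBall
    (A : Set X) x r (∑ p ∈ A, |r p|)
    (fun p hp => (le_abs_self _).trans
      (Finset.single_le_sum (f := fun p => |r p|) (fun _ _ => abs_nonneg _) hp)) 5 (by norm_num)
  have hufin : u.Finite := A.finite_toSet.subset huA
  lift u to Finset X using hufin
  have huA' : ∀ b ∈ u, b ∈ A := fun b hb => huA hb
  have hTu : T ⊆ ⋃ b ∈ u, closedBall (x b) (6 * r b) := by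
    intro y hy
    obtain ⟨p, hp, hyp⟩ := mem_iUnion₂.1 (hT hy)
    obtain ⟨b, hb, hpb⟩ := hcov p hp
    refine mem_iUnion₂.2 ⟨b, hb, ?_⟩
    have h1 := hpb (hpx p hp)
    rw [mem_closedBall] at h1 hyp ⊢
    have := dist_triangle y p (x b)
    have := hr b (huA' b hb)
    linarith
  have hcard : ∑ b ∈ u, (S.filter (· ∈ closedBall (x b) (r b))).card ≤ S.card := by
    rw [← Finset.card_biUnion]
    · exact Finset.card_le_card (Finset.biUnion_subset.2 fun b _ => Finset.filter_subset _ _)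
    · intro b hb b' hb' hbb'
      rw [Function.onFun, Finset.disjoint_left]
      intro y hy hy'
      exact (Set.disjoint_left.1 (hdisj hb hb' hbb')) (Finset.mem_filter.1 hy).2
        (Finset.mem_filter.1 hy').2
  have hball : ∀ b ∈ u, hausdorffContent s hs (closedBall (x b) (6 * r b)) ≤
      ENNReal.ofReal (2 * (12 * δ) ^ s * (S.filter (· ∈ closedBall (x b) (r b))).card) := by
    intro b hb
    have hrb := hr b (huA' b hb)
    have hr0 : 0 < r b := hδ.trans_le hrb
    have hd : ediam (closedBall (x b) (6 * r b)) ≤ ENNReal.ofReal (12 * r b) := by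
      refine (ediam_le fun y hy z hz => ?_)
      rw [edist_dist]
      refine ENNReal.ofReal_le_ofReal ?_
      have := dist_triangle_right y z (x b)
      rw [mem_closedBall] at hy hz
      linarith
    refine (hausdorffContent_le_ediam hs _).trans ((ENNReal.rpow_le_rpow hd hs.le).trans ?_)
    rw [ENNReal.ofReal_rpow_of_pos (by positivity)]
    refine ENNReal.ofReal_le_ofReal ?_
    have hsplit : 12 * r b = 12 * δ * (r b / δ) := by field_simp
    rw [hsplit, Real.mul_rpow (by positivity) (by positivity)]
    have := hfill b (huA' b hb)
    have h0 : 0 ≤ (12 * δ) ^ s := by positivity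
    nlinarith
  calc hausdorffContent s hs T ≤ hausdorffContent s hs (⋃ b ∈ u, closedBall (x b) (6 * r b)) :=
        measure_mono hTu
    _ ≤ ∑ b ∈ u, hausdorffContent s hs (closedBall (x b) (6 * r b)) := measure_biUnion_finset_le _ _
    _ ≤ ∑ b ∈ u, ENNReal.ofReal (2 * (12 * δ) ^ s *
          (S.filter (· ∈ closedBall (x b) (r b))).card) := Finset.sum_le_sum hball
    _ = ENNReal.ofReal (2 * (12 * δ) ^ s *
          ∑ b ∈ u, ((S.filter (· ∈ closedBall (x b) (r b))).card : ℝ)) := by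
        rw [Finset.mul_sum, ENNReal.ofReal_sum_of_nonneg]
        intro b _
        positivity
    _ ≤ _ := by
        refine ENNReal.ofReal_le_ofReal ?_
        have : (∑ b ∈ u, ((S.filter (· ∈ closedBall (x b) (r b))).card : ℝ)) ≤ S.card := by
          exact_mod_cast hcard
        gcongr

/-! ### The invariant measure of the planes almost orthogonal to a vector -/

theorem isometryOf_mul_apply {n : ℕ} (g h : O n) (x : E n) :
    isometryOf (g * h) x = isometryOf g (isometryOf h x) := by
  simp [isometryOf_apply]

theorem isometryOf_symm_apply {n : ℕ} (g : O n) (x : E n) :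
    (isometryOf g).symm x = isometryOf g⁻¹ x := by
  apply (isometryOf g).injective
  rw [LinearIsometryEquiv.apply_symm_apply, ← isometryOf_mul_apply, mul_inv_cancel,
    isometryOf_apply]
  simp

/-- `O(n)` acts transitively on spheres: two vectors of the same length are exchanged by a
reflection. -/
theorem exists_isometryOf_eq {n : ℕ} {x y : E n} (h : ‖x‖ = ‖y‖) :
    ∃ g : O n, isometryOf g x = y := by
  let L : E n ≃ₗᵢ[ℝ] E n := (ℝ ∙ (x - y))ᗮ.reflection
  let U := Unitary.linearIsometryEquiv.symm L
  let g : O n := ⟨(Matrix.toEuclideanCLM (n := Fin n) (𝕜 := ℝ)).symm U.1,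
    Unitary.map_mem (Matrix.toEuclideanCLM (n := Fin n) (𝕜 := ℝ)).symm U.2⟩
  refine ⟨g, ?_⟩
  rw [isometryOf_apply]
  simp only [g, StarAlgEquiv.apply_symm_apply]
  change L x = y
  exact Submodule.reflection_sub h

theorem norm_starProjection_rotate {n m : ℕ} (g : O n) (V : Grassmannian n m) (x : E n) :
    ‖(rotate g V).1.starProjection x‖ = ‖V.1.starProjection (isometryOf g⁻¹ x)‖ := by
  have := Submodule.starProjection_map_apply (isometryOf g) V.1 x
  rw [isometryOf_symm_apply] at this
  exact (congrArg norm this).trans ((isometryOf g).norm_map _)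

theorem continuous_starProjection_apply {n m : ℕ} (x : E n) :
    Continuous fun V : Grassmannian n m => V.1.starProjection x := by
  have hi : IsInducing (fun V : Grassmannian n m => V.1.starProjection) := ⟨rfl⟩
  exact hi.continuous.clm_apply continuous_const

theorem abs_coord_le_norm_starProjection_coordPlane {n m : ℕ} (h : m ≤ n) (y : E n) (i : Fin m) :
    |y (Fin.castLE h i)| ≤ ‖(coordPlane h).1.starProjection y‖ := by
  set e : E n := EuclideanSpace.basisFun (Fin n) ℝ (Fin.castLE h i) with he
  have hmem : e ∈ (coordPlane h).1 := Submodule.subset_span ⟨i, rfl⟩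
  have h1 : y (Fin.castLE h i) = inner ℝ e y := by
    simp [he, EuclideanSpace.inner_single_left]
  have h2 : inner ℝ e y = inner ℝ e ((coordPlane h).1.starProjection y) := by
    rw [← Submodule.inner_starProjection_left_eq_right,
      Submodule.starProjection_eq_self_iff.2 hmem]
  rw [h1, h2]
  refine (abs_real_inner_le_norm _ _).trans ?_
  have : ‖e‖ = 1 := by simp [he]
  rw [this, one_mul]

theorem prod_ite_castLE {n m : ℕ} (h : m ≤ n) (a b : ℝ≥0∞) :
    ∏ i : Fin n, (if (i : ℕ) < m then a else b) = a ^ m * b ^ (n - m) := by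
  obtain ⟨k, rfl⟩ := Nat.exists_eq_add_of_le h
  rw [Fin.prod_univ_add]
  simp

/-- A slab of the unit ball around the orthogonal complement of the coordinate plane is contained
in a box with `m` short sides. -/
theorem volume_slab_le {n m : ℕ} (h : m ≤ n) {ρ : ℝ} (hρ : 0 ≤ ρ) :
    volume {y : E n | y ∈ closedBall (0 : E n) 1 ∧ ‖(coordPlane h).1.starProjection y‖ ≤ ρ * ‖y‖} ≤
      ENNReal.ofReal (2 ^ n * ρ ^ m) := by
  set b : Fin n → ℝ := fun i => if (i : ℕ) < m then ρ else 1 with hb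
  have hsub : {y : E n | y ∈ closedBall (0 : E n) 1 ∧
      ‖(coordPlane h).1.starProjection y‖ ≤ ρ * ‖y‖} ⊆ (WithLp.ofLp) ⁻¹' (Icc (-b) b) := by
    rintro y ⟨hy, hyρ⟩
    rw [mem_closedBall_zero_iff] at hy
    have : ∀ i, |y i| ≤ b i := by
      intro i
      by_cases hi : (i : ℕ) < m
      · have := abs_coord_le_norm_starProjection_coordPlane h y ⟨i, hi⟩
        simp only [hb, if_pos hi]
        exact this.trans (hyρ.trans (by nlinarith [norm_nonneg y]))
      · simp only [hb, if_neg hi]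
        exact (PiLp.norm_apply_le y i).trans hy
    exact ⟨fun i => (abs_le.1 (this i)).1, fun i => (abs_le.1 (this i)).2⟩
  refine (measure_mono hsub).trans ?_
  rw [(PiLp.volume_preserving_ofLp (Fin n)).measure_preimage measurableSet_Icc.nullMeasurableSet,
    Real.volume_Icc_pi]
  have : ∀ i : Fin n, ENNReal.ofReal (b i - (-b) i) =
      if (i : ℕ) < m then ENNReal.ofReal (2 * ρ) else ENNReal.ofReal 2 := by
    intro i
    by_cases hi : (i : ℕ) < m
    · simp only [hb, Pi.neg_apply, if_pos hi]; congr 1; ring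
    · simp only [hb, Pi.neg_apply, if_neg hi]; congr 1; ring
  simp_rw [this]
  rw [prod_ite_castLE h, ← ENNReal.ofReal_pow (by positivity), ← ENNReal.ofReal_pow (by positivity),
    ← ENNReal.ofReal_mul (by positivity)]
  refine ENNReal.ofReal_le_ofReal (le_of_eq ?_)
  obtain ⟨k, rfl⟩ := Nat.exists_eq_add_of_le h
  rw [Nat.add_sub_cancel_left, mul_pow, pow_add]
  ring

instance (n : ℕ) : SecondCountableTopology (O n) :=
  haveI : SecondCountableTopology (Matrix (Fin n) (Fin n) ℝ) :=
    inferInstanceAs (SecondCountableTopology (Fin n → Fin n → ℝ))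
  TopologicalSpace.Subtype.secondCountableTopology
    (Matrix.orthogonalGroup (Fin n) ℝ : Set (Matrix (Fin n) (Fin n) ℝ))

instance (n : ℕ) : (haarO n).IsMulLeftInvariant :=
  inferInstanceAs (Measure.haarMeasure ⊤ : Measure (O n)).IsMulLeftInvariant

theorem continuous_isometryOf_inv {n : ℕ} :
    Continuous fun q : O n × E n => isometryOf q.1⁻¹ q.2 := by
  have hL : Continuous (Matrix.toEuclideanCLM (n := Fin n) (𝕜 := ℝ)) :=
    (Matrix.toEuclideanCLM (n := Fin n) (𝕜 := ℝ)).toAlgEquiv.toLinearMap.continuous_of_finiteDimensional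
  have h2 : Continuous fun q : O n × E n =>
      Matrix.toEuclideanCLM (n := Fin n) (𝕜 := ℝ) (q.1⁻¹).1 :=
    hL.comp (continuous_subtype_val.comp (continuous_inv.comp continuous_fst))
  exact h2.clm_apply continuous_snd

/-- The rotations carrying the coordinate plane to a plane almost orthogonal to `e` form a set whose
measure is the same for all `e`, so it may be averaged over the unit ball; by Fubini the average is
controlled by the volume of a slab. -/
theorem haarO_nearly_orthogonal_le {n m : ℕ} (h : m ≤ n) {ρ : ℝ} (hρ : 0 ≤ ρ) {e : E n}
    (he : e ≠ 0) :
    haarO n {g | ‖(coordPlane h).1.starProjection (isometryOf g⁻¹ e)‖ ≤ ρ * ‖e‖} *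
      volume (closedBall (0 : E n) 1) ≤ ENNReal.ofReal (2 ^ n * ρ ^ m) := by
  set A : E n → Set (O n) := fun x =>
    {g | ‖(coordPlane h).1.starProjection (isometryOf g⁻¹ x)‖ ≤ ρ * ‖x‖} with hA
  have hAe : ∀ x : E n, x ≠ 0 → haarO n (A x) = haarO n (A e) := by
    intro x hx
    have hxe : ‖(‖e‖ / ‖x‖) • x‖ = ‖e‖ := by
      rw [norm_smul, norm_div, norm_norm, norm_norm, div_mul_cancel₀ _ (norm_ne_zero_iff.2 hx)]
    obtain ⟨k, hk⟩ := exists_isometryOf_eq hxe.symm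
    have hc : 0 < ‖e‖ / ‖x‖ := div_pos (norm_pos_iff.2 he) (norm_pos_iff.2 hx)
    have h1 : A x = (fun g => k⁻¹ * g) ⁻¹' A e := by
      ext g
      simp only [hA, mem_ofPred_eq, mem_preimage, mul_inv_rev, inv_inv]
      rw [isometryOf_mul_apply, hk, map_smul, map_smul, norm_smul, Real.norm_of_nonneg hc.le]
      have h2 : ρ * ‖e‖ = ‖e‖ / ‖x‖ * (ρ * ‖x‖) := by
        field_simp [norm_ne_zero_iff.2 hx]
      rw [h2, mul_le_mul_iff_right₀ hc]
    rw [h1, measure_preimage_mul]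
  set D : Set (O n × E n) := {q | q.2 ∈ closedBall (0 : E n) 1 ∧
    ‖(coordPlane h).1.starProjection (isometryOf q.1⁻¹ q.2)‖ ≤ ρ * ‖q.2‖} with hD
  have hDc : IsClosed D := by
    have h1 : IsClosed {q : O n × E n | q.2 ∈ closedBall (0 : E n) 1} :=
      isClosed_closedBall.preimage continuous_snd
    have h2 : IsClosed {q : O n × E n |
        ‖(coordPlane h).1.starProjection (isometryOf q.1⁻¹ q.2)‖ ≤ ρ * ‖q.2‖} :=
      isClosed_le ((coordPlane h).1.starProjection.continuous.comp continuous_isometryOf_inv).norm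
        (by fun_prop)
    exact h1.inter h2
  have hDm : MeasurableSet D := hDc.measurableSet
  have hleft : haarO n (A e) * volume (closedBall (0 : E n) 1) ≤ ((haarO n).prod volume) D := by
    rw [Measure.prod_apply_symm hDm]
    have hne : Nontrivial (E n) := ⟨e, 0, he⟩
    calc haarO n (A e) * volume (closedBall (0 : E n) 1)
        = ∫⁻ _ in closedBall (0 : E n) 1, haarO n (A e) := by rw [setLIntegral_const]
      _ = ∫⁻ x, (closedBall (0 : E n) 1).indicator (fun _ => haarO n (A e)) x :=
          (lintegral_indicator measurableSet_closedBall _).symm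
      _ ≤ ∫⁻ x, haarO n ((fun g => (g, x)) ⁻¹' D) := by
          refine lintegral_mono_ae ?_
          have h0 : ∀ᵐ x : E n, x ≠ 0 := by
            simp [ae_iff]
          filter_upwards [h0] with x hx
          by_cases hxb : x ∈ closedBall (0 : E n) 1
          · rw [indicator_of_mem hxb, ← hAe x hx]
            exact measure_mono fun g hg => ⟨hxb, hg⟩
          · rw [indicator_of_notMem hxb]
            exact bot_le
  refine hleft.trans ?_
  rw [Measure.prod_apply hDm]
  refine (lintegral_mono (g := fun _ => ENNReal.ofReal (2 ^ n * ρ ^ m)) fun g => ?_).trans (by simp)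
  have hsec : Prod.mk g ⁻¹' D = (isometryOf g⁻¹) ⁻¹' {y : E n | y ∈ closedBall (0 : E n) 1 ∧
      ‖(coordPlane h).1.starProjection y‖ ≤ ρ * ‖y‖} := by
    ext x
    simp [hD]
  rw [hsec, (isometryOf g⁻¹).measurePreserving.measure_preimage_emb
    (isometryOf g⁻¹).toHomeomorph.measurableEmbedding]
  exact volume_slab_le h hρ

/-- Few planes are almost orthogonal to a given vector: the transversality of the family of
projections. -/
theorem exists_gammaMeasure_le {n m : ℕ} (h : m ≤ n) :
    ∃ C : ℝ, 0 < C ∧ ∀ (x : E n) (ρ : ℝ), x ≠ 0 → 0 ≤ ρ →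
      gammaMeasure h {V | ‖V.1.starProjection x‖ ≤ ρ} ≤ ENNReal.ofReal (C * (ρ / ‖x‖) ^ m) := by
  have hv0 : volume (closedBall (0 : E n) 1) ≠ 0 :=
    (measure_closedBall_pos _ _ one_pos).ne'
  have hvt : volume (closedBall (0 : E n) 1) ≠ ⊤ := measure_closedBall_lt_top.ne
  set v := (volume (closedBall (0 : E n) 1)).toReal with hv
  have hvpos : 0 < v := ENNReal.toReal_pos hv0 hvt
  have hvv : volume (closedBall (0 : E n) 1) = ENNReal.ofReal v := (ENNReal.ofReal_toReal hvt).symm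
  refine ⟨2 ^ n / v, by positivity, fun x ρ hx hρ => ?_⟩
  have hxp : 0 < ‖x‖ := norm_pos_iff.2 hx
  have hmeas : MeasurableSet {V : Grassmannian n m | ‖V.1.starProjection x‖ ≤ ρ} :=
    (isClosed_le (continuous_starProjection_apply x).norm continuous_const).measurableSet
  rw [gammaMeasure, Measure.map_apply (continuous_rotate _).measurable hmeas]
  have key := haarO_nearly_orthogonal_le h (div_nonneg hρ hxp.le) hx
  rw [div_mul_cancel₀ _ hxp.ne', hvv] at key
  have hset : (fun g => rotate g (coordPlane h)) ⁻¹'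
      {V : Grassmannian n m | ‖V.1.starProjection x‖ ≤ ρ} =
      {g | ‖(coordPlane h).1.starProjection (isometryOf g⁻¹ x)‖ ≤ ρ} := by
    ext g
    simp only [mem_preimage, mem_ofPred_eq, norm_starProjection_rotate]
  rw [hset]
  have hdiv : ENNReal.ofReal (2 ^ n / v * (ρ / ‖x‖) ^ m) =
      ENNReal.ofReal (2 ^ n * (ρ / ‖x‖) ^ m) / ENNReal.ofReal v := by
    rw [← ENNReal.ofReal_div_of_pos hvpos]
    congr 1
    ring
  rw [hdiv, ENNReal.le_div_iff_mul_le (Or.inl (by simpa using hvpos)) (Or.inl ENNReal.ofReal_ne_top)]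
  exact key

/-! ### Families of large subsets of a finite set -/

/-- Large subsets of `P` with small pairwise intersections are few, by the Cauchy–Schwarz
inequality applied to the function counting how many of them contain a given point. -/
theorem card_mul_le_of_pairwise_card_inter_le {α : Type*} [DecidableEq α] {P : Finset α}
    {𝒯 : Finset (Finset α)} (hsub : ∀ S ∈ 𝒯, S ⊆ P) {L : ℝ} (hL : 0 < L)
    (hcard : ∀ S ∈ 𝒯, L ≤ S.card)
    (hpair : ∀ S ∈ 𝒯, ∀ S' ∈ 𝒯, S ≠ S' → ((S ∩ S').card : ℝ) ≤ L ^ 2 / (2 * P.card)) :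
    𝒯.card * L ≤ 2 * P.card := by
  rcases P.eq_empty_or_nonempty with rfl | hP
  · have : 𝒯 = ∅ := by
      refine Finset.eq_empty_of_forall_notMem fun S hS => ?_
      have h1 := hcard S hS
      rw [Finset.subset_empty.1 (hsub S hS)] at h1
      simp at h1
      linarith
    simp [this]
  have hN : (0 : ℝ) < P.card := by exact_mod_cast Finset.card_pos.2 hP
  set f : α → ℝ := fun p => ∑ S ∈ 𝒯, if p ∈ S then 1 else 0 with hf
  set X : ℝ := ∑ S ∈ 𝒯, (S.card : ℝ) with hX
  have hsumf : ∑ p ∈ P, f p = X := by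
    rw [hf, Finset.sum_comm, hX]
    refine Finset.sum_congr rfl fun S hS => ?_
    rw [← Finset.sum_filter, Finset.sum_const, nsmul_one, Finset.filter_mem_eq_inter,
      Finset.inter_eq_right.2 (hsub S hS)]
  have hsumsq : ∑ p ∈ P, f p ^ 2 = ∑ S ∈ 𝒯, ∑ S' ∈ 𝒯, ((S ∩ S').card : ℝ) := by
    simp_rw [hf, sq, Finset.sum_mul_sum]
    rw [Finset.sum_comm]
    refine Finset.sum_congr rfl fun S hS => ?_
    rw [Finset.sum_comm]
    refine Finset.sum_congr rfl fun S' hS' => ?_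
    have hite : ∀ p, ((if p ∈ S then 1 else 0) * (if p ∈ S' then 1 else 0) : ℝ) =
        if p ∈ S ∩ S' then 1 else 0 := fun p => by
      simp only [Finset.mem_inter, ite_and, mul_ite, mul_one, mul_zero]
      split_ifs <;> rfl
    simp_rw [hite]
    rw [← Finset.sum_filter, Finset.sum_const, nsmul_one, Finset.filter_mem_eq_inter,
      Finset.inter_eq_right.2 (Finset.inter_subset_left.trans (hsub S hS))]
  have hCS : X ^ 2 ≤ P.card * ∑ p ∈ P, f p ^ 2 := by
    rw [← hsumf]; exact sq_sum_le_card_mul_sum_sq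
  have hrow : ∀ S ∈ 𝒯, ∑ S' ∈ 𝒯, ((S ∩ S').card : ℝ) ≤
      S.card + 𝒯.card * (L ^ 2 / (2 * P.card)) := by
    intro S hS
    rw [← Finset.add_sum_erase _ _ hS, Finset.inter_self]
    gcongr
    refine (Finset.sum_le_card_nsmul _ _ _ fun S' hS' =>
      hpair S hS S' (Finset.mem_of_mem_erase hS') (Finset.ne_of_mem_erase hS').symm).trans ?_
    rw [nsmul_eq_mul]
    gcongr
    exact Finset.erase_subset _ _
  have hXL : 𝒯.card * L ≤ X := by
    rw [← nsmul_eq_mul]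
    exact Finset.card_nsmul_le_sum _ _ _ hcard
  have hsum : ∑ p ∈ P, f p ^ 2 ≤ X + 𝒯.card * (𝒯.card * (L ^ 2 / (2 * P.card))) := by
    rw [hsumsq]
    refine (Finset.sum_le_sum hrow).trans ?_
    rw [Finset.sum_add_distrib, Finset.sum_const, nsmul_eq_mul]
  have hX0 : 0 ≤ X := le_trans (by positivity) hXL
  have hfin : X ^ 2 ≤ P.card * X + X ^ 2 / 2 := by
    calc X ^ 2 ≤ P.card * (X + 𝒯.card * (𝒯.card * (L ^ 2 / (2 * P.card)))) :=
          hCS.trans (by gcongr)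
      _ = P.card * X + (𝒯.card * L) ^ 2 / 2 := by field_simp
      _ ≤ _ := by gcongr
  have : X ≤ 2 * P.card := by
    rcases hX0.eq_or_lt with h | h
    · rw [← h]; positivity
    · nlinarith
  exact hXL.trans this

/-- Any family of large subsets of `P` has a small subfamily such that each member of the family
meets some member of the subfamily in a large set. -/
theorem exists_subfamily_card_inter_ge {α : Type*} [DecidableEq α] {P : Finset α} {𝒮 : Finset (Finset α)}
    (hsub : ∀ S ∈ 𝒮, S ⊆ P) {L : ℝ} (hL : 0 < L) (hcard : ∀ S ∈ 𝒮, L ≤ S.card) :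
    ∃ 𝒯 ⊆ 𝒮, 𝒯.card * L ≤ 2 * P.card ∧
      ∀ S ∈ 𝒮, ∃ T ∈ 𝒯, L ^ 2 / (2 * P.card) ≤ ((S ∩ T).card : ℝ) := by
  set θ : ℝ := L ^ 2 / (2 * P.card) with hθ
  have hne : (𝒮.powerset.filter fun 𝒯 => ∀ S ∈ 𝒯, ∀ S' ∈ 𝒯, S ≠ S' →
      ((S ∩ S').card : ℝ) ≤ θ).Nonempty := ⟨∅, by simp⟩
  obtain ⟨𝒯, h𝒯⟩ := Finset.exists_maximal hne
  have hm := h𝒯.prop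
  simp only [Finset.mem_filter, Finset.mem_powerset] at hm
  obtain ⟨h𝒯𝒮, hpair⟩ := hm
  refine ⟨𝒯, h𝒯𝒮, card_mul_le_of_pairwise_card_inter_le (fun S hS => hsub S (h𝒯𝒮 hS)) hL
    (fun S hS => hcard S (h𝒯𝒮 hS)) hpair, fun S hS => ?_⟩
  by_cases hST : S ∈ 𝒯
  · refine ⟨S, hST, ?_⟩
    rw [Finset.inter_self]
    have h1 : L ≤ S.card := hcard S hS
    have h2 : (S.card : ℝ) ≤ P.card := by exact_mod_cast Finset.card_le_card (hsub S hS)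
    rw [hθ, div_le_iff₀ (by linarith)]
    nlinarith
  · by_contra! hcon
    have hmem : insert S 𝒯 ∈ 𝒮.powerset.filter fun 𝒯 => ∀ S ∈ 𝒯, ∀ S' ∈ 𝒯, S ≠ S' →
        ((S ∩ S').card : ℝ) ≤ θ := by
      simp only [Finset.mem_filter, Finset.mem_powerset]
      refine ⟨Finset.insert_subset hS h𝒯𝒮, fun U hU U' hU' hne => ?_⟩
      rcases Finset.mem_insert.1 hU with rfl | hU1 <;>
        rcases Finset.mem_insert.1 hU' with rfl | hU2
      · exact absurd rfl hne
      · exact (hcon U' hU2).le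
      · rw [Finset.inter_comm]; exact (hcon U hU1).le
      · exact hpair U hU1 U' hU2 hne
    exact hST (h𝒯.le_of_ge hmem (Finset.subset_insert _ _) (Finset.mem_insert_self _ _))

/-! ### Counting pairs with nearby projections -/

/-- If `f` maps `S` into few balls, then many pairs of points of `S` have nearby images. -/
theorem card_sq_le_card_mul_card_close_pairs {α Y : Type*} [PseudoMetricSpace Y] (S : Finset α)
    (f : α → Y) (C : Finset Y) {ρ : ℝ} (h : ∀ p ∈ S, ∃ y ∈ C, dist (f p) y ≤ ρ) :
    S.card ^ 2 ≤ C.card *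
      ((S ×ˢ S).filter fun pq => dist (f pq.1) (f pq.2) ≤ 2 * ρ).card := by
  rcases S.eq_empty_or_nonempty with rfl | ⟨p₀, hp₀⟩
  · simp
  have : Nonempty Y := ⟨(h p₀ hp₀).choose⟩
  choose! y hyC hy using h
  have h1 : S.card = ∑ c ∈ C, (S.filter fun p => y p = c).card :=
    Finset.card_eq_sum_card_fiberwise hyC
  have h2 : (∑ c ∈ C, (S.filter fun p => y p = c).card) ^ 2 ≤
      C.card * ∑ c ∈ C, (S.filter fun p => y p = c).card ^ 2 := sq_sum_le_card_mul_sum_sq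
  rw [← h1] at h2
  refine h2.trans (Nat.mul_le_mul_left _ ?_)
  have h3 : ∀ c ∈ C, (S.filter fun p => y p = c).card ^ 2 =
      (((S.filter fun p => y p = c) ×ˢ (S.filter fun p => y p = c))).card := fun c _ => by
    rw [Finset.card_product, sq]
  rw [Finset.sum_congr rfl h3, ← Finset.card_biUnion]
  · refine Finset.card_le_card fun pq hpq => ?_
    simp only [Finset.mem_biUnion, Finset.mem_product, Finset.mem_filter] at hpq ⊢
    obtain ⟨c, _, ⟨h4, h5⟩, h6, h7⟩ := hpq
    refine ⟨⟨h4, h6⟩, ?_⟩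
    have h8 := hy _ h4
    have h9 := hy _ h6
    rw [h5] at h8
    rw [h7] at h9
    linarith [dist_triangle_right (f pq.1) (f pq.2) c]
  · intro c _ c' _ hcc'
    rw [Function.onFun, Finset.disjoint_left]
    intro pq h4 h5
    simp only [Finset.mem_product, Finset.mem_filter] at h4 h5
    exact hcc' (h4.1.2.symm.trans h5.1.2)

/-- The dyadic index `i` of the annulus `2 ^ i δ ≤ r < 2 ^ (i + 1) δ` containing `r`; it is `0` for
`r < δ`. -/
def annulusIndex (δ r : ℝ) : ℕ := Nat.log 2 ⌊r / δ⌋₊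

theorem le_two_pow_annulusIndex {δ r : ℝ} (hδ : 0 < δ) :
    r ≤ 2 ^ (annulusIndex δ r + 1) * δ := by
  rw [← div_le_iff₀ hδ]
  have h1 : ⌊r / δ⌋₊ < 2 ^ (annulusIndex δ r + 1) := Nat.lt_pow_succ_log_self one_lt_two _
  have h2 := Nat.lt_of_floor_lt h1
  exact_mod_cast h2.le

theorem two_pow_annulusIndex_le {δ r : ℝ} (hδ : 0 < δ) (h : δ ≤ r) :
    2 ^ annulusIndex δ r * δ ≤ r := by
  rw [← le_div_iff₀ hδ]
  have h0 : 1 ≤ r / δ := (one_le_div hδ).2 h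
  have h1 : 2 ^ annulusIndex δ r ≤ ⌊r / δ⌋₊ :=
    Nat.pow_log_le_self 2 (Nat.floor_pos.2 h0).ne'
  have h2 := Nat.floor_le (zero_le_one.trans h0)
  refine le_trans ?_ h2
  exact_mod_cast h1

theorem annulusIndex_eq_zero {δ r : ℝ} (hδ : 0 < δ) (h : r < δ) : annulusIndex δ r = 0 := by
  have : ⌊r / δ⌋₊ = 0 := Nat.floor_eq_zero.2 ((div_lt_one hδ).2 h)
  simp [annulusIndex, this]

theorem annulusIndex_lt {δ r : ℝ} {J : ℕ} (hδ : 0 < δ) (hJ : 0 < J) (h : r < 2 ^ J * δ) :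
    annulusIndex δ r < J := by
  rcases lt_or_ge r δ with h1 | h1
  · rwa [annulusIndex_eq_zero hδ h1]
  · have h2 := (two_pow_annulusIndex_le hδ h1).trans_lt h
    have h3 := lt_of_mul_lt_mul_right h2 hδ.le
    exact (pow_lt_pow_iff_right₀ (one_lt_two (α := ℝ))).1 h3

/-- The discrete Riesz potential of order `m` of a Frostman set. -/
theorem IsFrostman.sum_potential_le {X : Type*} [MetricSpace X] {T : Finset X} {s δ : ℝ}
    (hT : IsFrostman T s δ) (hδ : 0 < δ) (m : ℕ) {J : ℕ} (hJ : 0 < J) (p : X)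
    (hp : ∀ q ∈ T, dist q p < 2 ^ J * δ) :
    ∑ q ∈ T, ((2 : ℝ) ^ (-(m : ℝ))) ^ annulusIndex δ (dist q p) ≤
      J * ((2 : ℝ) ^ s * ((2 : ℝ) ^ max 0 (s - m)) ^ J) := by
  have hmap : ∀ q ∈ T, annulusIndex δ (dist q p) ∈ Finset.range J := fun q hq =>
    Finset.mem_range.2 (annulusIndex_lt hδ hJ (hp q hq))
  rw [← Finset.sum_fiberwise_of_maps_to hmap]
  have hone : (1 : ℝ) ≤ 2 ^ max 0 (s - m) :=
    Real.one_le_rpow one_le_two (le_max_left _ _)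
  have hterm : ∀ i ∈ Finset.range J,
      ∑ q ∈ T.filter (fun q => annulusIndex δ (dist q p) = i),
        ((2 : ℝ) ^ (-(m : ℝ))) ^ annulusIndex δ (dist q p) ≤
      (2 : ℝ) ^ s * ((2 : ℝ) ^ max 0 (s - m)) ^ J := by
    intro i hi
    have h1 : ∑ q ∈ T.filter (fun q => annulusIndex δ (dist q p) = i),
        ((2 : ℝ) ^ (-(m : ℝ))) ^ annulusIndex δ (dist q p) =
        (T.filter (fun q => annulusIndex δ (dist q p) = i)).card *
          ((2 : ℝ) ^ (-(m : ℝ))) ^ i := by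
      rw [← nsmul_eq_mul, ← Finset.sum_const]
      exact Finset.sum_congr rfl fun q hq => by rw [(Finset.mem_filter.1 hq).2]
    have h2 : ((T.filter (fun q => annulusIndex δ (dist q p) = i)).card : ℝ) ≤
        (2 ^ (i + 1) : ℝ) ^ s := by
      have h3 := hT p (2 ^ (i + 1) * δ) (le_mul_of_one_le_left hδ.le (one_le_pow₀ one_le_two))
      rw [mul_div_cancel_right₀ _ hδ.ne'] at h3
      refine le_trans ?_ h3
      have : T.filter (fun q => annulusIndex δ (dist q p) = i) ⊆
          T.filter (· ∈ closedBall p (2 ^ (i + 1) * δ)) := by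
        intro q hq
        simp only [Finset.mem_filter, mem_closedBall] at hq ⊢
        refine ⟨hq.1, ?_⟩
        have := le_two_pow_annulusIndex (r := dist q p) hδ
        rwa [hq.2] at this
      exact_mod_cast Finset.card_le_card this
    rw [h1]
    calc _ ≤ (2 ^ (i + 1) : ℝ) ^ s * ((2 : ℝ) ^ (-(m : ℝ))) ^ i := by gcongr
      _ = (2 : ℝ) ^ s * ((2 : ℝ) ^ (s - m)) ^ i := by
        rw [← Real.rpow_natCast, ← Real.rpow_natCast, ← Real.rpow_natCast,
          ← Real.rpow_mul zero_le_two, ← Real.rpow_mul zero_le_two, ← Real.rpow_mul zero_le_two,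
          ← Real.rpow_add two_pos, ← Real.rpow_add two_pos]
        congr 1
        push_cast
        ring
      _ ≤ (2 : ℝ) ^ s * ((2 : ℝ) ^ max 0 (s - m)) ^ i := by
        gcongr
        · exact one_le_two
        · exact le_max_right _ _
      _ ≤ (2 : ℝ) ^ s * ((2 : ℝ) ^ max 0 (s - m)) ^ J := by
        gcongr
        exact (Finset.mem_range.1 hi).le
  refine (Finset.sum_le_sum hterm).trans ?_
  rw [Finset.sum_const, Finset.card_range, nsmul_eq_mul]

/-- The transversality estimate for `gammaMeasure`, in dyadic form. -/
theorem exists_gammaMeasure_pair_le {n m : ℕ} (h : m ≤ n) :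
    ∃ C : ℝ, 0 < C ∧ ∀ (p q : E n) (δ : ℝ), 0 < δ →
      gammaMeasure h {V | dist (V.1.starProjection p) (V.1.starProjection q) ≤ 4 * δ} ≤
        ENNReal.ofReal (C * ((2 : ℝ) ^ (-(m : ℝ))) ^ annulusIndex δ (dist q p)) := by
  obtain ⟨C, hC, hCγ⟩ := exists_gammaMeasure_le h
  refine ⟨max 1 (C * 4 ^ m), by positivity, fun p q δ hδ => ?_⟩
  rcases lt_or_ge (dist q p) δ with h1 | h1
  · rw [annulusIndex_eq_zero hδ h1, pow_zero, mul_one]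
    refine prob_le_one.trans ?_
    rw [← ENNReal.ofReal_one]
    exact ENNReal.ofReal_le_ofReal (le_max_left _ _)
  · have hpq : p - q ≠ 0 := by
      rw [← norm_pos_iff, ← dist_eq_norm, dist_comm]
      exact hδ.trans_le h1
    have hset : {V : Grassmannian n m |
        dist (V.1.starProjection p) (V.1.starProjection q) ≤ 4 * δ} =
        {V | ‖V.1.starProjection (p - q)‖ ≤ 4 * δ} := by
      ext V
      simp [dist_eq_norm]
    rw [hset]
    refine (hCγ _ _ hpq (by positivity)).trans (ENNReal.ofReal_le_ofReal ?_)
    rw [← dist_eq_norm, dist_comm]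
    have h2 := two_pow_annulusIndex_le hδ h1
    set i := annulusIndex δ (dist q p)
    have hd : 0 < dist q p := hδ.trans_le h1
    have h3 : 4 * δ / dist q p ≤ 4 * (2 ^ i)⁻¹ := by
      rw [div_le_iff₀ hd]
      have : (2 ^ i : ℝ)⁻¹ * (2 ^ i * δ) = δ := by field_simp
      have h4 : (2 ^ i : ℝ)⁻¹ * (2 ^ i * δ) ≤ (2 ^ i : ℝ)⁻¹ * dist q p := by gcongr
      linarith
    calc C * (4 * δ / dist q p) ^ m ≤ C * (4 * (2 ^ i)⁻¹) ^ m := by gcongr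
      _ = C * 4 ^ m * ((2 : ℝ) ^ (-(m : ℝ))) ^ i := by
        rw [mul_pow, mul_assoc, Real.rpow_neg zero_le_two, Real.rpow_natCast, inv_pow, inv_pow,
          ← pow_mul, ← pow_mul, mul_comm i m]
      _ ≤ _ := by
        gcongr
        exact le_max_right _ _

/-- Planes for which a Frostman set has many pairs with nearby projections are rare, by Markov's
inequality. -/
theorem exists_gammaMeasure_many_pairs_le {n m : ℕ} (h : m ≤ n) :
    ∃ C : ℝ, 0 < C ∧ ∀ (T : Finset (E n)) (s δ : ℝ) (J : ℕ), IsFrostman T s δ → 0 < δ → 0 < J →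
      (∀ p ∈ T, ∀ q ∈ T, dist q p < 2 ^ J * δ) → ∀ a : ℝ, 0 < a →
      gammaMeasure h {V | a ≤ (((T ×ˢ T).filter fun pq =>
        dist (V.1.starProjection pq.1) (V.1.starProjection pq.2) ≤ 4 * δ).card : ℝ)} ≤
        ENNReal.ofReal (C * T.card * (J * ((2 : ℝ) ^ s * ((2 : ℝ) ^ max 0 (s - m)) ^ J)) / a) := by
  obtain ⟨C, hC, hCγ⟩ := exists_gammaMeasure_pair_le h
  refine ⟨C, hC, fun T s δ J hT hδ hJ hdiam a ha => ?_⟩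
  set B : E n × E n → Set (Grassmannian n m) := fun pq =>
    {V | dist (V.1.starProjection pq.1) (V.1.starProjection pq.2) ≤ 4 * δ} with hB
  have hBm : ∀ pq, MeasurableSet (B pq) := fun pq =>
    (isClosed_le ((continuous_starProjection_apply pq.1).dist
      (continuous_starProjection_apply pq.2)) continuous_const).measurableSet
  set F : Grassmannian n m → ℝ≥0∞ := fun V => ∑ pq ∈ T ×ˢ T, (B pq).indicator 1 V with hF
  have hFm : Measurable F :=
    Finset.measurable_sum _ fun pq _ => measurable_one.indicator (hBm pq)
  have hFcard : ∀ V, F V = (((T ×ˢ T).filter fun pq =>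
      dist (V.1.starProjection pq.1) (V.1.starProjection pq.2) ≤ 4 * δ).card : ℝ≥0∞) := by
    intro V
    rw [Finset.card_filter]
    push_cast
    refine Finset.sum_congr rfl fun pq _ => ?_
    simp only [hB, indicator_apply, mem_ofPred_eq, Pi.one_apply]
  have hint : ∫⁻ V, F V ∂(gammaMeasure h) ≤ ENNReal.ofReal
      (C * T.card * (J * ((2 : ℝ) ^ s * ((2 : ℝ) ^ max 0 (s - m)) ^ J))) := by
    rw [hF, lintegral_finsetSum _ fun pq _ => measurable_one.indicator (hBm pq)]
    simp_rw [lintegral_indicator_one (hBm _)]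
    calc ∑ pq ∈ T ×ˢ T, gammaMeasure h (B pq)
        ≤ ∑ pq ∈ T ×ˢ T, ENNReal.ofReal
            (C * ((2 : ℝ) ^ (-(m : ℝ))) ^ annulusIndex δ (dist pq.2 pq.1)) :=
          Finset.sum_le_sum fun pq _ => hCγ pq.1 pq.2 δ hδ
      _ = ENNReal.ofReal (∑ p ∈ T, C * ∑ q ∈ T,
            ((2 : ℝ) ^ (-(m : ℝ))) ^ annulusIndex δ (dist q p)) := by
          rw [← ENNReal.ofReal_sum_of_nonneg fun pq _ => by positivity, Finset.sum_product]
          simp_rw [Finset.mul_sum]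
      _ ≤ _ := by
          refine ENNReal.ofReal_le_ofReal ?_
          refine (Finset.sum_le_card_nsmul T _
            (C * (J * ((2 : ℝ) ^ s * ((2 : ℝ) ^ max 0 (s - m)) ^ J))) fun p hp => ?_).trans
            (le_of_eq ?_)
          · exact mul_le_mul_of_nonneg_left
              (hT.sum_potential_le hδ m hJ p (hdiam p hp)) hC.le
          · rw [nsmul_eq_mul]; ring
  have hsub : {V : Grassmannian n m | a ≤ (((T ×ˢ T).filter fun pq =>
        dist (V.1.starProjection pq.1) (V.1.starProjection pq.2) ≤ 4 * δ).card : ℝ)} ⊆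
      {V | ENNReal.ofReal a ≤ F V} := by
    intro V hV
    rw [mem_ofPred_eq] at hV ⊢
    rw [hFcard, ← ENNReal.ofReal_natCast]
    exact ENNReal.ofReal_le_ofReal hV
  refine (measure_mono hsub).trans ?_
  refine (meas_ge_le_lintegral_div hFm.aemeasurable (by simpa using ha) ENNReal.ofReal_ne_top).trans
    ?_
  rw [ENNReal.ofReal_div_of_pos ha]
  exact ENNReal.div_le_div_right hint _

/-! ### Exceptional planes at a fixed scale -/

/-- The planes `V` for which some Frostman subset of `P` of cardinality at least `L` has its
projection to `V` covered by at most `M` balls of radius `2 δ`; the centres may lie off `V`. -/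
def badPlanes {n : ℕ} (m : ℕ) (P : Finset (E n)) (s δ L M : ℝ) : Set (Grassmannian n m) :=
  {V | ∃ S ⊆ P, IsFrostman S s δ ∧ L ≤ S.card ∧ ∃ Y : Finset (E n), (Y.card : ℝ) ≤ M ∧
    ∀ p ∈ S, ∃ y ∈ Y, dist (V.1.starProjection p) y ≤ 2 * δ}

/-- The key estimate. When `L` is close to the cardinality of `P`, the Frostman subsets of `P` all
have large intersection with one of a few of them, and for each of these few the exceptional planes
are controlled by the pair count. -/
theorem exists_gammaMeasure_badPlanes_le {n m : ℕ} (h : m ≤ n) :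
    ∃ C : ℝ, 0 < C ∧ ∀ (P : Finset (E n)) (s δ L M : ℝ) (J : ℕ), 0 < δ → 0 < L → 0 < M → 0 < J →
      (∀ p ∈ P, ∀ q ∈ P, dist q p < 2 ^ J * δ) →
      gammaMeasure h (badPlanes m P s δ L M) ≤ ENNReal.ofReal
        (C * P.card ^ 4 * M * (J * ((2 : ℝ) ^ s * ((2 : ℝ) ^ max 0 (s - m)) ^ J)) / L ^ 5) := by
  obtain ⟨C, hC, hCγ⟩ := exists_gammaMeasure_many_pairs_le h
  refine ⟨8 * C, by positivity, fun P s δ L M J hδ hL hM hJ hdiam => ?_⟩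
  rcases P.eq_empty_or_nonempty with rfl | hP
  · have : badPlanes m (∅ : Finset (E n)) s δ L M = ∅ := by
      refine eq_empty_of_forall_notMem ?_
      rintro V ⟨S, hS, -, hLS, -⟩
      rw [Finset.subset_empty.1 hS] at hLS
      simp at hLS
      linarith
    simp [this]
  have hN : (0 : ℝ) < P.card := by exact_mod_cast Finset.card_pos.2 hP
  set Z : ℝ := J * ((2 : ℝ) ^ s * ((2 : ℝ) ^ max 0 (s - m)) ^ J) with hZ
  have hZ0 : 0 ≤ Z := by positivity
  set 𝒮 := P.powerset.filter fun S => IsFrostman S s δ ∧ L ≤ S.card with h𝒮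
  have hmem : ∀ S, S ∈ 𝒮 ↔ S ⊆ P ∧ IsFrostman S s δ ∧ L ≤ S.card := fun S => by
    simp [h𝒮]
  obtain ⟨𝒯, h𝒯𝒮, h𝒯card, h𝒯⟩ := exists_subfamily_card_inter_ge (P := P) (𝒮 := 𝒮)
    (fun S hS => ((hmem S).1 hS).1) hL (fun S hS => ((hmem S).1 hS).2.2)
  set θ : ℝ := L ^ 2 / (2 * P.card) with hθ
  have hθ0 : 0 < θ := by positivity
  have hcover : badPlanes m P s δ L M ⊆ ⋃ T ∈ 𝒯, {V : Grassmannian n m |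
      θ ^ 2 / M ≤ (((T ×ˢ T).filter fun pq =>
        dist (V.1.starProjection pq.1) (V.1.starProjection pq.2) ≤ 4 * δ).card : ℝ)} := by
    rintro V ⟨S, hSP, hSF, hLS, Y, hYM, hY⟩
    obtain ⟨T, hT, hST⟩ := h𝒯 S ((hmem S).2 ⟨hSP, hSF, hLS⟩)
    refine mem_iUnion₂.2 ⟨T, hT, ?_⟩
    rw [mem_ofPred_eq, div_le_iff₀ hM]
    have h1 := card_sq_le_card_mul_card_close_pairs (S ∩ T) (fun p => V.1.starProjection p) Y
      (fun p hp => hY p (Finset.inter_subset_left hp))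
    have h2 : (((S ∩ T) ×ˢ (S ∩ T)).filter fun pq =>
        dist (V.1.starProjection pq.1) (V.1.starProjection pq.2) ≤ 2 * (2 * δ)).card ≤
        ((T ×ˢ T).filter fun pq =>
        dist (V.1.starProjection pq.1) (V.1.starProjection pq.2) ≤ 4 * δ).card := by
      rw [← mul_assoc, show (2 : ℝ) * 2 = 4 by norm_num]
      exact Finset.card_le_card (Finset.filter_subset_filter _
        (Finset.product_subset_product Finset.inter_subset_right Finset.inter_subset_right))
    have h3 : (((S ∩ T).card : ℝ)) ^ 2 ≤ Y.card * (((T ×ˢ T).filter fun pq =>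
        dist (V.1.starProjection pq.1) (V.1.starProjection pq.2) ≤ 4 * δ).card : ℝ) := by
      exact_mod_cast h1.trans (Nat.mul_le_mul_left _ h2)
    rw [mul_comm _ M]
    exact (pow_le_pow_left₀ hθ0.le hST 2).trans
      (h3.trans (mul_le_mul_of_nonneg_right hYM (Nat.cast_nonneg _)))
  refine (measure_mono hcover).trans ((measure_biUnion_finset_le _ _).trans ?_)
  calc ∑ T ∈ 𝒯, gammaMeasure h {V : Grassmannian n m |
        θ ^ 2 / M ≤ (((T ×ˢ T).filter fun pq =>
          dist (V.1.starProjection pq.1) (V.1.starProjection pq.2) ≤ 4 * δ).card : ℝ)}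
      ≤ ∑ T ∈ 𝒯, ENNReal.ofReal (C * P.card * Z / (θ ^ 2 / M)) := by
        refine Finset.sum_le_sum fun T hT => ?_
        obtain ⟨hTP, hTF, -⟩ := (hmem T).1 (h𝒯𝒮 hT)
        refine (hCγ T s δ J hTF hδ hJ (fun p hp q hq => hdiam p (hTP hp) q (hTP hq)) _
          (by positivity)).trans (ENNReal.ofReal_le_ofReal ?_)
        have : (T.card : ℝ) ≤ P.card := by exact_mod_cast Finset.card_le_card hTP
        gcongr
    _ = ENNReal.ofReal (𝒯.card * (C * P.card * Z / (θ ^ 2 / M))) := by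
        rw [Finset.sum_const, nsmul_eq_mul, ENNReal.ofReal_mul (by positivity),
          ENNReal.ofReal_natCast]
    _ ≤ _ := by
        refine ENNReal.ofReal_le_ofReal ?_
        have h1 : (𝒯.card : ℝ) ≤ 2 * P.card / L := (le_div_iff₀ hL).2 h𝒯card
        calc (𝒯.card : ℝ) * (C * P.card * Z / (θ ^ 2 / M))
            ≤ 2 * P.card / L * (C * P.card * Z / (θ ^ 2 / M)) := by gcongr
          _ = _ := by rw [hθ]; field_simp; ring

/-! ### Nets at dyadic scales -/

/-- A bound on the upper box dimension gives efficient nets at all small dyadic scales `2⁻ʲ`. -/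
theorem exists_nets_of_upperBoxDim_lt {n : ℕ} {F : Set (E n)} (hF : Bornology.IsBounded F) {a : ℝ}
    (h : upperBoxDim F < ENNReal.ofReal a) :
    ∃ J₀ : ℕ, 0 < J₀ ∧ ∃ P : ℕ → Finset (E n), (∀ j, ((P j).card : ℝ) ≤ ((2 : ℝ) ^ j) ^ a) ∧
      (∀ j, ∀ p ∈ P j, ∀ q ∈ P j, dist q p < 2 ^ J₀) ∧
      ∀ᶠ j in atTop, F ⊆ ⋃ p ∈ P j, closedBall p ((2 : ℝ) ^ j)⁻¹ := by
  obtain ⟨R, hR⟩ := hF.subset_closedBall (0 : E n)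
  obtain ⟨J₁, hJ₁⟩ := pow_unbounded_of_one_lt (2 * R + 2) (one_lt_two (α := ℝ))
  have hev : ∀ᶠ δ : ℝ in 𝓝[>] 0,
      ENNReal.ofReal (Real.log (coveringNumber F δ) / (-Real.log δ)) < ENNReal.ofReal a :=
    eventually_lt_of_limsup_lt h
  have hδ : Tendsto (fun j : ℕ => ((2 : ℝ) ^ j)⁻¹) atTop (𝓝[>] 0) := by
    refine tendsto_nhdsWithin_iff.2 ⟨?_, .of_forall fun j => by simp⟩
    exact tendsto_inv_atTop_zero.comp (tendsto_pow_atTop_atTop_of_one_lt one_lt_two)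
  have hgood := (hδ.eventually hev).and (eventually_ge_atTop 1)
  have hex : ∀ j : ℕ, ∃ P : Finset (E n), (P.card : ℝ) ≤ ((2 : ℝ) ^ j) ^ a ∧
      (∀ p ∈ P, ∀ q ∈ P, dist q p < 2 ^ (J₁ + 1)) ∧
      ((ENNReal.ofReal (Real.log (coveringNumber F ((2 : ℝ) ^ j)⁻¹) /
        (-Real.log ((2 : ℝ) ^ j)⁻¹)) < ENNReal.ofReal a ∧ 1 ≤ j) →
        F ⊆ ⋃ p ∈ P, closedBall p ((2 : ℝ) ^ j)⁻¹) := by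
    intro j
    by_cases hj : ENNReal.ofReal (Real.log (coveringNumber F ((2 : ℝ) ^ j)⁻¹) /
        (-Real.log ((2 : ℝ) ^ j)⁻¹)) < ENNReal.ofReal a ∧ 1 ≤ j
    swap
    -- At the finitely many large scales without an efficient cover the net is empty.
    · exact ⟨∅, by simp; positivity, by simp, fun h => absurd h hj⟩
    have hδj : (0 : ℝ) < ((2 : ℝ) ^ j)⁻¹ := by positivity
    have hδj1 : ((2 : ℝ) ^ j)⁻¹ ≤ 1 := inv_le_one_of_one_le₀ (one_le_pow₀ one_le_two)
    have hne : {k : ℕ | ∃ c : Finset (E n), c.card = k ∧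
        F ⊆ ⋃ x ∈ c, ball x ((2 : ℝ) ^ j)⁻¹}.Nonempty := by
      have htb : TotallyBounded F := (isCompact_closedBall (0 : E n) R).totallyBounded.subset hR
      obtain ⟨c, hc, hFc⟩ := Metric.totallyBounded_iff.1 htb _ hδj
      exact ⟨_, hc.toFinset, rfl, by simpa using hFc⟩
    obtain ⟨c, hc, hFc⟩ := Nat.sInf_mem hne
    refine ⟨c.filter fun x => (ball x ((2 : ℝ) ^ j)⁻¹ ∩ F).Nonempty, ?_, ?_, fun _ => ?_⟩
    · have h1 : ((c.filter fun x => (ball x ((2 : ℝ) ^ j)⁻¹ ∩ F).Nonempty).card : ℝ) ≤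
          coveringNumber F ((2 : ℝ) ^ j)⁻¹ := by
        rw [coveringNumber, ← hc]
        exact_mod_cast Finset.card_filter_le _ _
      refine h1.trans ?_
      rcases Nat.eq_zero_or_pos (coveringNumber F ((2 : ℝ) ^ j)⁻¹) with h0 | h0
      · rw [h0]; simp; positivity
      · have h0' : (0 : ℝ) < coveringNumber F ((2 : ℝ) ^ j)⁻¹ := by exact_mod_cast h0
        have h2 := (ENNReal.ofReal_lt_ofReal_iff_of_nonneg (by
          refine div_nonneg (Real.log_natCast_nonneg _) ?_
          rw [Real.log_inv, neg_neg]
          exact Real.log_nonneg (one_le_pow₀ one_le_two))).1 hj.1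
        rw [Real.log_inv, neg_neg] at h2
        have h3 : 0 < Real.log ((2 : ℝ) ^ j) :=
          Real.log_pos (one_lt_pow₀ one_lt_two (by omega))
        rw [div_lt_iff₀ h3] at h2
        rw [← Real.log_le_log_iff h0' (by positivity), Real.log_rpow (by positivity)]
        exact h2.le
    · intro p hp q hq
      obtain ⟨-, x, hxp, hxF⟩ := Finset.mem_filter.1 hp
      obtain ⟨-, y, hyq, hyF⟩ := Finset.mem_filter.1 hq
      have h1 := hR hxF
      have h2 := hR hyF
      rw [mem_ball] at hxp hyq
      rw [mem_closedBall] at h1 h2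
      have h3 : dist q p ≤ dist q y + dist y x + dist x p := dist_triangle4 _ _ _ _
      have h4 : dist y x ≤ dist y 0 + dist x 0 := dist_triangle_right _ _ _
      have h5 : (2 : ℝ) ^ J₁ ≤ 2 ^ (J₁ + 1) := pow_le_pow_right₀ one_le_two (by omega)
      rw [dist_comm q y] at h3
      linarith
    · intro x hx
      obtain ⟨p, hp, hxp⟩ := mem_iUnion₂.1 (hFc hx)
      exact mem_iUnion₂.2 ⟨p, Finset.mem_filter.2 ⟨hp, x, hxp, hx⟩, ball_subset_closedBall hxp⟩
  choose P hP1 hP2 hP3 using hex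
  exact ⟨J₁ + 1, by omega, P, hP1, hP2, hgood.mono fun j hj => hP3 j hj⟩

/-- A set of content zero is covered by balls of dyadic radii `2⁻ʲ`, `j ≥ j₀`, with a controlled
number of balls of each radius. -/
theorem exists_dyadic_cover_of_hausdorffContent_eq_zero {X : Type*} [MetricSpace X] [Nonempty X]
    {t : ℝ} (ht : 0 < t) {A : Set X} (h : hausdorffContent t ht A = 0) (j₀ : ℕ) :
    ∃ Y : ℕ → Finset X, (∀ j, ((Y j).card : ℝ) ≤ ((2 : ℝ) ^ (j + 1)) ^ t) ∧
      ∀ x ∈ A, ∃ j, j₀ ≤ j ∧ ∃ y ∈ Y j, dist x y ≤ ((2 : ℝ) ^ j)⁻¹ := by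
  set η : ℝ≥0∞ := ENNReal.ofReal ((((2 : ℝ) ^ j₀)⁻¹) ^ t) with hη
  have hη0 : 0 < η := by rw [hη, ENNReal.ofReal_pos]; positivity
  have hη1 : η ≤ 1 := by
    rw [hη, ← ENNReal.ofReal_one]
    exact ENNReal.ofReal_le_ofReal (Real.rpow_le_one (by positivity)
      (inv_le_one_of_one_le₀ (one_le_pow₀ one_le_two)) ht.le)
  have hη2 : η / 2 ≠ 0 := (ENNReal.half_pos hη0.ne').ne'
  obtain ⟨u, hAu, hu⟩ := exists_cover_of_hausdorffContent_lt ht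
    (h.trans_lt (pos_iff_ne_zero.2 hη2))
  -- The radii are enlarged by summable amounts: covering sets may be singletons, of diameter `0`.
  obtain ⟨w, hw0, hw⟩ := ENNReal.exists_pos_sum_of_countable' hη2 ℕ
  set b : ℕ → ℝ≥0∞ := fun i => ediam (u i) ^ t + w i with hb
  have hbsum : ∑' i, b i ≤ η := by
    rw [hb, ENNReal.tsum_add, ← ENNReal.add_halves η]
    exact add_le_add hu.le hw.le
  have hbη : ∀ i, b i ≤ η := fun i => (ENNReal.le_tsum i).trans hbsum
  have hbtop : ∀ i, b i ≠ ⊤ := fun i =>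
    ((hbη i).trans_lt (hη1.trans_lt ENNReal.one_lt_top)).ne
  have hb0 : ∀ i, 0 < b i := fun i => (hw0 i).trans_le le_add_self
  set r : ℕ → ℝ := fun i => (b i).toReal ^ t⁻¹ with hr
  have hr0 : ∀ i, 0 < r i := fun i =>
    Real.rpow_pos_of_pos (ENNReal.toReal_pos (hb0 i).ne' (hbtop i)) _
  have hrt : ∀ i, r i ^ t = (b i).toReal := fun i => by
    rw [hr, ← Real.rpow_mul ENNReal.toReal_nonneg, inv_mul_cancel₀ ht.ne', Real.rpow_one]
  have hrb : ∀ i, ENNReal.ofReal (r i ^ t) = b i := fun i => by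
    rw [hrt, ENNReal.ofReal_toReal (hbtop i)]
  have hrle : ∀ i, r i ≤ ((2 : ℝ) ^ j₀)⁻¹ := fun i => by
    rw [← Real.rpow_le_rpow_iff (hr0 i).le (by positivity) ht]
    have := hbη i
    rw [← hrb, hη] at this
    exact (ENNReal.ofReal_le_ofReal_iff (by positivity)).1 this
  have hcenter : ∀ i, ∃ y, u i ⊆ closedBall y (r i) := by
    intro i
    rcases (u i).eq_empty_or_nonempty with h0 | ⟨y, hy⟩
    · exact ⟨Classical.arbitrary X, by simp [h0]⟩
    · refine ⟨y, fun x hx => ?_⟩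
      rw [mem_closedBall, ← ENNReal.ofReal_le_ofReal_iff (hr0 i).le, ← edist_dist,
        ← ENNReal.rpow_le_rpow_iff ht, ENNReal.ofReal_rpow_of_pos (hr0 i), hrb]
      exact (ENNReal.rpow_le_rpow (edist_le_ediam_of_mem hx hy) ht.le).trans le_self_add
  choose y hy using hcenter
  have hfin : ∀ j : ℕ, ∃ Y : Finset X, (Y.card : ℝ) ≤ ((2 : ℝ) ^ (j + 1)) ^ t ∧
      ∀ i, ((2 : ℝ) ^ (j + 1))⁻¹ ≤ r i → y i ∈ Y := by
    intro j
    have hpos : (0 : ℝ) < (((2 : ℝ) ^ (j + 1))⁻¹) ^ t := by positivity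
    obtain ⟨hf, hcard⟩ := ENNReal.finset_card_const_le_le_of_tsum_le ENNReal.one_ne_top
      (hbsum.trans hη1) (ENNReal.ofReal_pos.2 hpos).ne'
    refine ⟨hf.toFinset.image y, ?_, fun i hi => ?_⟩
    · refine le_trans (Nat.cast_le.2 Finset.card_image_le) ?_
      rw [one_div, ← ENNReal.ofReal_inv_of_pos hpos, ← ENNReal.ofReal_natCast,
        ENNReal.ofReal_le_ofReal_iff (by positivity), ← Real.inv_rpow (by positivity),
        inv_inv] at hcard
      exact hcard
    · refine Finset.mem_image_of_mem y ?_
      rw [Finite.mem_toFinset, mem_ofPred_eq, ← hrb]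
      exact ENNReal.ofReal_le_ofReal (Real.rpow_le_rpow (by positivity) hi ht.le)
  choose Y hYcard hYmem using hfin
  refine ⟨Y, hYcard, fun x hx => ?_⟩
  obtain ⟨i, hi⟩ := mem_iUnion.1 (hAu hx)
  have hr1 : r i ≤ 1 := (hrle i).trans (inv_le_one_of_one_le₀ (one_le_pow₀ one_le_two))
  obtain ⟨j, hj1, hj2⟩ := exists_nat_pow_near_of_lt_one (hr0 i) hr1
    (show (0 : ℝ) < 2⁻¹ by norm_num) (show (2 : ℝ)⁻¹ < 1 by norm_num)
  rw [inv_pow] at hj1 hj2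
  refine ⟨j, ?_, y i, hYmem j i hj1.le, (mem_closedBall.1 (hy i hi)).trans hj2⟩
  have h1 := hj1.trans_le (hrle i)
  have h2 := (inv_lt_inv₀ (by positivity) (by positivity)).1 h1
  have h3 := (pow_lt_pow_iff_right₀ (one_lt_two (α := ℝ))).1 h2
  omega

/-! ### Projections of sets of positive content -/

/-- If `K` has positive `s`-dimensional content and, at every small dyadic scale, no large Frostman
subset of the net `P j` is projected by `f` into few balls, then the image of `K` has positive
`t`-dimensional content: otherwise a cover of the image splits `K` into pieces, one for each scale,
whose contents are too small to sum up to that of `K`. -/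
theorem hausdorffContent_image_ne_zero {X : Type*} [MetricSpace X] [Nonempty X] {s t : ℝ}
    (hs : 0 < s) (ht : 0 < t) {K : Set X} (hK : hausdorffContent s hs K ≠ 0) {f : X → X}
    (hf : LipschitzWith 1 f) {P : ℕ → Finset X} {L : ℕ → ℝ}
    (hP : ∀ᶠ j in atTop, K ⊆ ⋃ p ∈ P j, closedBall p ((2 : ℝ) ^ j)⁻¹)
    (hL : ∑' j, ENNReal.ofReal (2 * (12 * ((2 : ℝ) ^ j)⁻¹) ^ s * L j) ≠ ⊤)
    (hgood : ∀ᶠ j in atTop, ∀ S ⊆ P j, IsFrostman S s ((2 : ℝ) ^ j)⁻¹ → L j ≤ S.card →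
      ∀ Y : Finset X, (Y.card : ℝ) ≤ ((2 : ℝ) ^ (j + 1)) ^ t →
        ¬ ∀ p ∈ S, ∃ y ∈ Y, dist (f p) y ≤ 2 * ((2 : ℝ) ^ j)⁻¹) :
    hausdorffContent t ht (f '' K) ≠ 0 := by
  intro h0
  have htail := (ENNReal.tendsto_sum_nat_add _ hL).eventually (gt_mem_nhds (pos_iff_ne_zero.2 hK))
  obtain ⟨j₁, hj₁⟩ := eventually_atTop.1 (hP.and hgood)
  obtain ⟨j₀, hj₀tail, hj₀⟩ := (htail.and (eventually_ge_atTop j₁)).exists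
  obtain ⟨Y, hYcard, hY⟩ := exists_dyadic_cover_of_hausdorffContent_eq_zero ht h0 j₀
  set T : ℕ → Set X := fun j => {x ∈ K | ∃ y ∈ Y j, dist (f x) y ≤ ((2 : ℝ) ^ j)⁻¹} with hT
  have hKT : K ⊆ ⋃ k, T (k + j₀) := by
    intro x hx
    obtain ⟨j, hj, y, hy, hxy⟩ := hY (f x) (mem_image_of_mem f hx)
    refine mem_iUnion.2 ⟨j - j₀, ?_⟩
    rw [Nat.sub_add_cancel hj]
    exact ⟨hx, y, hy, hxy⟩
  have hTle : ∀ j, j₁ ≤ j → hausdorffContent s hs (T j) ≤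
      ENNReal.ofReal (2 * (12 * ((2 : ℝ) ^ j)⁻¹) ^ s * L j) := by
    intro j hj
    obtain ⟨hPj, hgj⟩ := hj₁ j hj
    have hδ : (0 : ℝ) < ((2 : ℝ) ^ j)⁻¹ := by positivity
    obtain ⟨S, hSA, hSF, hS⟩ := exists_isFrostman_subset
      ((P j).filter fun p => ∃ x ∈ T j, dist x p ≤ ((2 : ℝ) ^ j)⁻¹) hs hδ
    refine (hS (T j) fun x hx => ?_).trans (ENNReal.ofReal_le_ofReal ?_)
    · obtain ⟨p, hp, hxp⟩ := mem_iUnion₂.1 (hPj hx.1)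
      exact mem_iUnion₂.2 ⟨p, Finset.mem_filter.2 ⟨hp, x, hx, hxp⟩, hxp⟩
    · have hlt : (S.card : ℝ) < L j := by
        by_contra! hge
        refine hgj S (hSA.trans (Finset.filter_subset _ _)) hSF hge (Y j) (hYcard j) fun p hp => ?_
        obtain ⟨-, x, ⟨-, y, hy, hxy⟩, hxp⟩ := Finset.mem_filter.1 (hSA hp)
        refine ⟨y, hy, ?_⟩
        have h1 : dist (f x) (f p) ≤ dist x p := by simpa using hf.dist_le_mul x p
        have h2 := dist_triangle_left (f p) y (f x)
        linarith
      gcongr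
  have : hausdorffContent s hs K < hausdorffContent s hs K := by
    calc hausdorffContent s hs K ≤ hausdorffContent s hs (⋃ k, T (k + j₀)) := measure_mono hKT
      _ ≤ ∑' k, hausdorffContent s hs (T (k + j₀)) := measure_iUnion_le _
      _ ≤ ∑' k, ENNReal.ofReal (2 * (12 * ((2 : ℝ) ^ (k + j₀))⁻¹) ^ s * L (k + j₀)) :=
          ENNReal.tsum_le_tsum fun k => hTle _ (hj₀.trans (Nat.le_add_left _ _))
      _ < _ := hj₀tail
  exact this.false

/-! ### The almost sure lower bound -/

theorem two_pow_rpow (j : ℕ) (x : ℝ) : ((2 : ℝ) ^ j) ^ x = ((2 : ℝ) ^ x) ^ j := by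
  rw [← Real.rpow_natCast, ← Real.rpow_natCast, ← Real.rpow_mul zero_le_two,
    ← Real.rpow_mul zero_le_two, mul_comm]

theorem summable_exceptional_bound (C a t s ℓ z : ℝ) (J₀ : ℕ) (h : 4 * a + t + z < 5 * ℓ) :
    Summable fun j : ℕ => C * (((2 : ℝ) ^ j) ^ a) ^ 4 * ((2 : ℝ) ^ (j + 1)) ^ t *
      (((j + J₀ : ℕ) : ℝ) * ((2 : ℝ) ^ s * ((2 : ℝ) ^ z) ^ (j + J₀))) / (((2 : ℝ) ^ j) ^ ℓ) ^ 5 := by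
  set ρ : ℝ := (2 : ℝ) ^ (4 * a + t + z - 5 * ℓ) with hρ
  have hρ0 : 0 < ρ := by positivity
  have hρ1 : ‖ρ‖ < 1 := by
    rw [Real.norm_of_nonneg hρ0.le]
    exact Real.rpow_lt_one_of_one_lt_of_neg one_lt_two (by linarith)
  have hρe : ρ = ((2 : ℝ) ^ a) ^ 4 * (2 : ℝ) ^ t * (2 : ℝ) ^ z / ((2 : ℝ) ^ ℓ) ^ 5 := by
    rw [hρ, Real.rpow_sub two_pos, Real.rpow_add two_pos, Real.rpow_add two_pos,
      mul_comm 4 a, mul_comm 5 ℓ, Real.rpow_mul zero_le_two, Real.rpow_mul zero_le_two]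
    norm_cast
  have h1 := summable_pow_mul_geometric_of_norm_lt_one 1 hρ1
  have h2 := summable_pow_mul_geometric_of_norm_lt_one 0 hρ1
  have h3 := ((h1.add (h2.mul_left (J₀ : ℝ))).mul_left
    (C * (2 : ℝ) ^ t * (2 : ℝ) ^ s * ((2 : ℝ) ^ z) ^ J₀))
  refine h3.congr fun j => ?_
  simp only [two_pow_rpow]
  have hℓ : (2 : ℝ) ^ ℓ ≠ 0 := by positivity
  rw [hρe]
  push_cast
  generalize (2 : ℝ) ^ a = A
  generalize (2 : ℝ) ^ t = T
  generalize (2 : ℝ) ^ z = Z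
  generalize (2 : ℝ) ^ s = S
  generalize (2 : ℝ) ^ ℓ = Λ at *
  rw [div_pow, mul_pow, mul_pow, ← pow_mul, ← pow_mul, ← pow_mul, ← pow_mul, mul_comm 4 j,
    mul_comm 5 j]
  field_simp
  ring

/-- If the upper box dimension of a bounded set is close to the Hausdorff dimension of a subset
`K`, almost every projection of `K` has large Hausdorff dimension. The numerical condition makes the
measures of the exceptional sets at the scales `2⁻ʲ` summable. -/
theorem ae_le_dimH_starProjection_image {n m : ℕ} (h : m ≤ n) {F K : Set (E n)}
    (hF : Bornology.IsBounded F) (hKF : K ⊆ F) {a s t ε : ℝ} (ht : 0 < t) (hs : 0 < s)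
    (hε : 0 < ε) (hFa : upperBoxDim F < ENNReal.ofReal a) (hKs : ENNReal.ofReal s < dimH K)
    (hexp : 4 * a + t + max 0 (s - m) < 5 * (s - ε)) :
    ∀ᵐ V ∂(gammaMeasure h : Measure (Grassmannian n m)),
      ENNReal.ofReal t ≤ dimH ((fun x => V.1.starProjection x) '' K) := by
  obtain ⟨J₀, hJ₀, P, hPcard, hPdiam, hPcov⟩ := exists_nets_of_upperBoxDim_lt hF hFa
  obtain ⟨C, hC, hCγ⟩ := exists_gammaMeasure_badPlanes_le h
  set L : ℕ → ℝ := fun j => ((2 : ℝ) ^ j) ^ (s - ε) with hL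
  set M : ℕ → ℝ := fun j => ((2 : ℝ) ^ (j + 1)) ^ t with hM
  have hbad : ∑' j, gammaMeasure h (badPlanes m (P j) s ((2 : ℝ) ^ j)⁻¹ (L j) (M j)) ≠ ⊤ := by
    refine ne_top_of_le_ne_top
      (summable_exceptional_bound C a t s (s - ε) (max 0 (s - m)) J₀ hexp).tsum_ofReal_ne_top
      (ENNReal.tsum_le_tsum fun j => ?_)
    refine (hCγ (P j) s _ (L j) (M j) (j + J₀) (by positivity) (by positivity) (by positivity)
      (by omega) fun p hp q hq => ?_).trans (ENNReal.ofReal_le_ofReal ?_)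
    · refine (hPdiam j p hp q hq).trans_le (le_of_eq ?_)
      rw [pow_add, mul_comm, ← mul_assoc, inv_mul_cancel₀ (by positivity), one_mul]
    · have := hPcard j
      gcongr
  have hsumL : ∑' j : ℕ, ENNReal.ofReal (2 * (12 * ((2 : ℝ) ^ j)⁻¹) ^ s * L j) ≠ ⊤ := by
    have hr : (2 : ℝ) ^ (-ε) < 1 := Real.rpow_lt_one_of_one_lt_of_neg one_lt_two (by linarith)
    have hsum := (summable_geometric_of_lt_one (by positivity) hr).mul_left (2 * (12 : ℝ) ^ s)
    refine (hsum.congr fun j => ?_).tsum_ofReal_ne_top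
    rw [Real.mul_rpow (by norm_num) (by positivity), Real.inv_rpow (by positivity)]
    simp only [hL]
    rw [Real.rpow_sub (by positivity), ← two_pow_rpow, Real.rpow_neg (by positivity)]
    field_simp
  have hcontent : hausdorffContent s hs K ≠ 0 := by
    intro h0
    have h1 := hausdorffMeasure_eq_zero_of_hausdorffContent hs h0
    have h2 : μH[(s.toNNReal : ℝ)] K = ⊤ := hausdorffMeasure_of_lt_dimH hKs
    rw [Real.coe_toNNReal s hs.le, h1] at h2
    exact ENNReal.zero_ne_top h2
  filter_upwards [ae_eventually_notMem hbad] with V hV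
  have hne := hausdorffContent_image_ne_zero hs ht hcontent
    (f := fun x => V.1.starProjection x) V.1.lipschitzWith_starProjection (P := P) (L := L)
    (hPcov.mono fun j hj => hKF.trans hj) hsumL
    (hV.mono fun j hj S hS hSF hSL Y hY hcov => hj ⟨S, hS, hSF, hSL, Y, hY, hcov⟩)
  have hpos : μH[(t.toNNReal : ℝ)] ((fun x => V.1.starProjection x) '' K) ≠ 0 := by
    rw [Real.coe_toNNReal t ht.le]
    intro h0
    exact hne (le_antisymm ((hausdorffContent_le_hausdorffMeasure ht _).trans h0.le) bot_le)
  exact le_dimH_of_hausdorffMeasure_ne_zero hpos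

/-- Countable stability of both dimensions reduces sets of equal Hausdorff and packing dimension to
the bounded case. -/
theorem ae_le_dimH_starProjection_image_of_dimH_eq_packingDim {n m : ℕ} (h : m ≤ n)
    {K : Set (E n)} (hK : dimH K = packingDim K) {t : ℝ} (ht : 0 < t)
    (htK : ENNReal.ofReal t < min (dimH K) m) :
    ∀ᵐ V ∂(gammaMeasure h : Measure (Grassmannian n m)),
      ENNReal.ofReal t ≤ dimH ((fun x => V.1.starProjection x) '' K) := by
  have htop : dimH K ≠ ⊤ := Real.dimH_ne_top K
  set d : ℝ := (dimH K).toReal with hd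
  have hdK : ENNReal.ofReal d = dimH K := ENNReal.ofReal_toReal htop
  obtain ⟨htd, htm⟩ := lt_min_iff.1 htK
  rw [← hdK] at htd
  have htd' : t < d := (ENNReal.ofReal_lt_ofReal_iff_of_nonneg ht.le).1 htd
  have htm' : t < m := by
    rw [← ENNReal.ofReal_natCast] at htm
    exact (ENNReal.ofReal_lt_ofReal_iff_of_nonneg ht.le).1 htm
  -- The exponents `a = d + ε`, `s = d - ε` lose at most `14 ε` in the summability condition.
  set ε : ℝ := (min d m - t) / 15 with hε
  have hε0 : 0 < ε := by
    have := lt_min htd' htm'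
    rw [hε]; linarith
  have h15 : 15 * ε = min d m - t := by rw [hε]; ring
  have hmind : min d (m : ℝ) ≤ d := min_le_left _ _
  have hpack : packingDim K < ENNReal.ofReal (d + ε) := by
    rw [← hK, ← hdK]
    exact (ENNReal.ofReal_lt_ofReal_iff (by linarith)).2 (by linarith)
  simp only [packingDim, iInf_lt_iff] at hpack
  obtain ⟨F, ⟨hFb, hKF⟩, hF⟩ := hpack
  have hFi : ∀ i, upperBoxDim (F i) < ENNReal.ofReal (d + ε) := fun i =>
    (le_iSup (fun i => upperBoxDim (F i)) i).trans_lt hF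
  have hKeq : K = ⋃ i, K ∩ F i := by rw [← inter_iUnion, inter_eq_left.2 hKF]
  have hsup : ENNReal.ofReal (d - ε) < ⨆ i, dimH (K ∩ F i) := by
    rw [← dimH_iUnion, ← hKeq, ← hdK]
    exact (ENNReal.ofReal_lt_ofReal_iff (by linarith)).2 (by linarith)
  obtain ⟨i, hi⟩ := lt_iSup_iff.1 hsup
  have hexp : 4 * (d + ε) + t + max 0 (d - ε - m) < 5 * (d - ε - ε) := by
    rcases le_total 0 (d - ε - m) with h0 | h0
    · rw [max_eq_right h0]
      have : min d (m : ℝ) = m := min_eq_right (by linarith)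
      linarith
    · rw [max_eq_left h0]
      linarith
  filter_upwards [ae_le_dimH_starProjection_image h (hFb i) inter_subset_right ht
    (by linarith) hε0 (hFi i) hi hexp] with V hV
  exact hV.trans (dimH_mono (image_mono inter_subset_left))

theorem dimH_orthogonalProjectionOnto_image_le {n m : ℕ} (V : Grassmannian n m) (K : Set (E n)) :
    dimH ((fun x => V.1.orthogonalProjectionOnto x) '' K) ≤ min (dimH K) m := by
  refine le_min (dimH_orthogonalProjectionOnto_le V.1 K) ?_
  refine (dimH_mono (subset_univ _)).trans (le_of_eq ?_)
  rw [Real.dimH_univ_eq_finrank, V.2]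

end RealProjection

end

theorem theorem1p2 (n m : ℕ) (hm : 0 < m) (hmn : m < n)
    (K : Set (EuclideanSpace ℝ (Fin n))) (hK : dimH K = RealProjection.packingDim K) :
    ∀ᵐ V ∂(RealProjection.gammaMeasure hmn.le : Measure (RealProjection.Grassmannian n m)),
      dimH ((fun x => V.1.orthogonalProjectionOnto x) '' K) = min (dimH K) (m : ENNReal) := by
  have hrat : ∀ᵐ V ∂(RealProjection.gammaMeasure hmn.le : Measure (RealProjection.Grassmannian n m)),
      ∀ q : ℚ, 0 < (q : ℝ) → ENNReal.ofReal q < min (dimH K) (m : ENNReal) →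
        ENNReal.ofReal q ≤ dimH ((fun x => V.1.starProjection x) '' K) := by
    rw [ae_all_iff]
    intro q
    by_cases hq : 0 < (q : ℝ) ∧ ENNReal.ofReal q < min (dimH K) (m : ENNReal)
    · filter_upwards [RealProjection.ae_le_dimH_starProjection_image_of_dimH_eq_packingDim hmn.le hK
        hq.1 hq.2] with V hV _ _
      exact hV
    · exact .of_forall fun V h1 h2 => absurd ⟨h1, h2⟩ hq
  filter_upwards [hrat] with V hV
  refine le_antisymm (RealProjection.dimH_orthogonalProjectionOnto_image_le V K) ?_
  have hiso : dimH ((fun x => V.1.starProjection x) '' K) =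
      dimH ((fun x => V.1.orthogonalProjectionOnto x) '' K) := by
    rw [← (V.1.subtypeₗᵢ.isometry).dimH_image ((fun x => V.1.orthogonalProjectionOnto x) '' K),
      image_image]
    rfl
  rw [← hiso]
  refine le_of_forall_lt fun c hc => ?_
  obtain ⟨q, hq0, hcq, hq⟩ := ENNReal.lt_iff_exists_rat_btwn.1 hc
  have hq' : 0 < (q : ℝ) := by
    have := bot_le.trans_lt hcq
    simpa using this
  exact hcq.trans_le (hV q hq' hq)
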